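/- **Conventions.** A *represented space* is a set $X$ with a surjective partial map $\delta_X:\subseteq\mathbb N^{\mathbb N}\to X$. A *problem* is a partial multi-valued map $f:\subseteq X\rightrightarrows Y$ between represented spaces, with $\operatorname{dom}(f)=\{x: f(x)\neq\emptyset\}$. A partial $F:\subseteq\mathbb N^{\mathbb N}\to\mathbb N^{\mathbb N}$ *realizes* $f$ ($F\vdash f$) if $\delta_YF(p)\in f(\delta_X(p))$ for all $p$ with $\delta_X(p)\in\operatorname{dom}(f)$. Write $f\le_W g$ if there are computable partial $H,K:\subseteq\mathbb N^{\mathbb N}\to\mathbb N^{\mathbb N}$ such that $H\langle\mathrm{id},GK\rangle\vdash f$ for all $G\vdash g$. A top element $\infty$ is added to the problems: $f\le_W\infty$ for all $f$, and $\infty\not\le_W g$ for $g\ne\infty$. Let $1$ denote $\mathrm{id}:\mathbb N^{\mathbb N}\to\mathbb N^{\mathbb N}$ and $0$ the nowhere defined problem on $\mathbb N^{\mathbb N}$. *Completion.* For $p\in\mathbb N^{\mathbb N}$ let $p-1$ arise from $p$ by erasing all zeros and decreasing the other entries by one. The completion of $X$ is $\overline X=X\cup\{\bot\}$ with the total representation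 $\delta_{\overline X}(p)=\delta_X(p-1)$ if $p-1\in\operatorname{dom}(\delta_X)$ and $\delta_{\overline X}(p)=\bot$ otherwise. The completion $\overline f:\overline X\rightrightarrows\overline Y$ is given by $\overline f(x)=f(x)$ for $x\in\operatorname{dom}(f)$ and $\overline f(x)=\overline Y$ otherwise. *Operations.* Products, disjoint unions and countable powers of represented spaces carry the usual representations. For $f:\subseteq X\rightrightarrows Y$ and $g:\subseteq U\rightrightarrows V$: - parallelization $\widehat f:\subseteq X^{\mathbb N}\rightrightarrows Y^{\mathbb N}$, $\widehat f((x_n)_n)=\prod_n f(x_n)$, with $\operatorname{dom}(\widehat f)=\operatorname{dom}(f)^{\mathbb N}$; - $f\sqcup g:\subseteq X\sqcup U\rightrightarrows Y\sqcup V$, $(0,x)\mapsto\{0\}\times f(x)$, $(1,u)\mapsto\{1\}\times g(u)$; - $f\sqcap g:\subseteq X\times U\rightrightarrows Y\sqcup V$, $(x,u)\mapsto f(x)\sqcup g(u)$, with $\operatorname{dom}(f\sqcap g)=\operatorname{dom}(f)\times\operatorname{dom}(g)$; - multiplicative implication $g\twoheadrightarrow f:\subseteq\mathbb N^{\mathbb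 N}\rightrightarrows\mathbb N^{\mathbb N}$, $(g\twoheadrightarrow f)(p)=\{\langle n,k,q\rangle:\emptyset\neq\varphi_n\langle q,g^{\mathrm r}\circ\varphi_k(p)\rangle\subseteq f^{\mathrm r}(p)\}$ if $\operatorname{dom}(g)\ne\emptyset$ or $\operatorname{dom}(f)=\emptyset$, and $(g\twoheadrightarrow f)=\infty$ otherwise. Here $\varphi$ is a Gödel numbering of the computable partial functions on $\mathbb N^{\mathbb N}$, $f^{\mathrm r}=\delta_Y^{-1}\circ f\circ\delta_X$ and $g^{\mathrm r}=\delta_V^{-1}\circ g\circ\delta_U$, and the composition requires that $\varphi_k(p)\in\operatorname{dom}(g^{\mathrm r})$ and that $\varphi_n\langle q,t\rangle$ is defined for every $t\in g^{\mathrm r}(\varphi_k(p))$. For $\infty$: $\overline\infty=\widehat\infty=\infty$, $f\sqcup\infty=\infty\sqcup f=\infty$, $f\sqcap\infty=\infty\sqcap f=f$, $(\infty\twoheadrightarrow f)=0$ for all $f$, and $(g\twoheadrightarrow\infty)=\infty$ for $g\neq\infty$. Put $f\le_{\mathrm{ptW}}g:\iff f\le_W\widehat{\overline g}$, $\;f\mathbin{\widehat{\overline\sqcap}}g:=\widehat{\overline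 f}\sqcap\widehat{\overline g}$, and $(g\Rrightarrow f):=(\widehat{\overline g}\twoheadrightarrow\widehat{\overline f})$. *Algebras.* A Brouwer algebra $(L,\le,\wedge,\vee,\to,\bot,\top)$ is a bounded lattice with bottom $\bot$ and top $\top$ and with a binary operation $\to$, antitone in its first and monotone in its second argument, such that $x\le y\vee z\iff(y\to x)\le z$ for all $x,y,z\in L$ (the dual of a Heyting algebra). **Theorem.** The relation $\le_{\mathrm{ptW}}$ is a preorder on the problems including $\infty$. On the class $\mathcal W_{\mathrm{ptW}}$ of its equivalence classes, the induced order and the operations induced by $\widehat{\overline\sqcap}$, $\sqcup$ and $\Rrightarrow$ are well-defined, and $$(\mathcal W_{\mathrm{ptW}},\le_{\mathrm{ptW}},\widehat{\overline\sqcap},\sqcup,\Rrightarrow,1,\infty)$$ is a Brouwer algebra: the meet is $\widehat{\overline\sqcap}$, the join is $\sqcup$, the implication is $\Rrightarrow$, the bottom element is the degree of $1$, and the top element is the degree of $\infty$. -/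

import Mathlib

/-! ### Baire space and computable functions on it -/

/-- Baire space `ℕ^ℕ`. -/
abbrev Baire : Type := ℕ → ℕ

namespace Baire

/-- `⟨p, q⟩(2n) = p n` and `⟨p, q⟩(2n+1) = q n`. -/
def pair (p q : Baire) : Baire := fun m => if m % 2 = 0 then p (m / 2) else q (m / 2)

/-- First component of `⟨p, q⟩`. -/
def fst (r : Baire) : Baire := fun n => r (2 * n)

/-- Second component of `⟨p, q⟩`. -/
def snd (r : Baire) : Baire := fun n => r (2 * n + 1)

/-- The `n`-th component of `⟨p₀, p₁, p₂, …⟩`, where `⟨p₀, p₁, p₂, …⟩⟨n, k⟩ = pₙ k` and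
`⟨n, k⟩` is the computable pairing bijection `Nat.pair` of `ℕ × ℕ` with `ℕ`. -/
def proj (n : ℕ) (r : Baire) : Baire := fun k => r (Nat.pair n k)

/-- The concatenation `n p` of a number with a sequence. -/
def cons (n : ℕ) (p : Baire) : Baire
  | 0 => n
  | k + 1 => p k

/-- The sequence without its first entry. -/
def tail (p : Baire) : Baire := fun k => p (k + 1)

/-- The code of the finite initial segment `(p 0, …, p (j-1))`. -/
def initSeg (p : Baire) (j : ℕ) : ℕ := Encodable.encode ((List.range j).map p)

/-- The sequence `p - 1`: the zeros of `p` are erased and all other entries are decreased by one.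
It is an element of Baire space exactly if `p` has infinitely many nonzero entries. -/
noncomputable def minusOne : Baire →. Baire := fun p =>
  ⟨{i | p i ≠ 0}.Infinite, fun _ n => p (Nat.nth (fun i => p i ≠ 0) n) - 1⟩

/-- What the `n`-th program says about the output digit `m` after having seen the first `j` entries
of the input `p`: `0` means "not yet known", `v + 1` means "the digit is `v`". -/
def query (n : ℕ) (p : Baire) (m j : ℕ) : Part ℕ :=
  (Denumerable.ofNat Nat.Partrec.Code n).eval (Nat.pair m (initSeg p j))

/-- The output digit `m` of the `n`-th program on input `p`: the program is run on longer and longer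
initial segments of `p` until it declares a digit. -/
def phiDigit (n : ℕ) (p : Baire) (m : ℕ) : Part ℕ :=
  (Nat.rfind fun j => (query n p m j).map fun v => decide (v ≠ 0)).bind
    fun j => (query n p m j).map Nat.pred

/-- The Gödel numbering `φ` of the computable partial functions on Baire space: `φ n` is defined on
`p` if the `n`-th program produces all the output digits. -/
def phi (n : ℕ) : Baire →. Baire := fun p =>
  ⟨∀ m, (phiDigit n p m).Dom, fun h m => (phiDigit n p m).get (h m)⟩

/-- A partial function on Baire space is computable if some `φ n` extends it. -/
def IsComputable (F : Baire →. Baire) : Prop := ∃ n, ∀ p, ∀ q ∈ F p, q ∈ phi n p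

theorem fst_pair (p q : Baire) : fst (pair p q) = p := by
  funext n; simp [fst, pair]

theorem snd_pair (p q : Baire) : snd (pair p q) = q := by
  funext n
  have h : (2 * n + 1) / 2 = n := by omega
  simp [snd, pair, h]

theorem minusOne_succ (q : Baire) : q ∈ minusOne (fun i => q i + 1) := by
  refine ⟨?_, ?_⟩
  · simp only [minusOne]
    simpa using Set.infinite_univ
  · funext n
    simp [minusOne, Nat.nth_true]

theorem minusOne_zero : ¬ (minusOne fun _ => 0).Dom := by
  simp [minusOne]

end Baire

/-! ### Represented spaces

A represented space has at most the cardinality of Baire space, so that it is no restriction to take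
its underlying set in the lowest universe. -/

/-- A set with a surjective partial map from Baire space onto it. -/
structure RepSpace where
  carrier : Type
  rep : Baire →. carrier
  rep_surj : ∀ x, ∃ p, x ∈ rep p

namespace RepSpace

/-- Baire space, represented by the identity. -/
def baire : RepSpace where
  carrier := Baire
  rep := fun p => Part.some p
  rep_surj := fun p => ⟨p, Part.mem_some p⟩

/-- `δ_{X × Y} ⟨p, q⟩ = (δ_X p, δ_Y q)`. -/
def prod (X Y : RepSpace) : RepSpace where
  carrier := X.carrier × Y.carrier
  rep := fun r => (X.rep r.fst).bind fun x => (Y.rep r.snd).map fun y => (x, y)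
  rep_surj := by
    rintro ⟨x, y⟩
    obtain ⟨p, hp⟩ := X.rep_surj x
    obtain ⟨q, hq⟩ := Y.rep_surj y
    refine ⟨Baire.pair p q, ?_⟩
    rw [Baire.fst_pair, Baire.snd_pair]
    exact Part.mem_bind hp (Part.mem_map _ hq)

/-- `δ_{X ⊔ Y} (0p) = (0, δ_X p)` and `δ_{X ⊔ Y} (1p) = (1, δ_Y p)`. -/
def sum (X Y : RepSpace) : RepSpace where
  carrier := X.carrier ⊕ Y.carrier
  rep := fun r => match r 0 with
    | 0 => (X.rep r.tail).map Sum.inl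
    | 1 => (Y.rep r.tail).map Sum.inr
    | _ => Part.none
  rep_surj := by
    rintro (x | y)
    · obtain ⟨p, hp⟩ := X.rep_surj x
      exact ⟨Baire.cons 0 p, Part.mem_map Sum.inl hp⟩
    · obtain ⟨p, hp⟩ := Y.rep_surj y
      exact ⟨Baire.cons 1 p, Part.mem_map Sum.inr hp⟩

/-- `δ_{X^ℕ} ⟨p₀, p₁, …⟩ = (δ_X p₀, δ_X p₁, …)`. -/
def seq (X : RepSpace) : RepSpace where
  carrier := ℕ → X.carrier
  rep := fun r =>
    ⟨∀ n, (X.rep (Baire.proj n r)).Dom, fun h n => (X.rep (Baire.proj n r)).get (h n)⟩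
  rep_surj := by
    intro x
    choose p hp using fun n => X.rep_surj (x n)
    have key : ∀ n, Baire.proj n (fun m => p m.unpair.1 m.unpair.2) = p n := by
      intro n; funext k; simp [Baire.proj]
    refine ⟨fun m => p m.unpair.1 m.unpair.2, ?_, ?_⟩
    · intro n; rw [key]; exact (hp n).1
    · funext n
      exact Part.get_eq_of_mem (by rw [key]; exact hp n) _

open Classical in
/-- The completion `X ∪ {⊥}`, with `none` in the role of `⊥` and with the total representation
`p ↦ δ_X (p - 1)` if this is defined, and `p ↦ ⊥` otherwise. -/
noncomputable def completion (X : RepSpace) : RepSpace where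
  carrier := Option X.carrier
  rep := fun p => Part.some ((Baire.minusOne p).bind X.rep).toOption
  rep_surj := by
    rintro (_ | x)
    · refine ⟨fun _ => 0, ?_⟩
      rw [Part.mem_some_iff, eq_comm, Part.toOption_eq_none_iff]
      exact fun h => Baire.minusOne_zero h.1
    · obtain ⟨q, hq⟩ := X.rep_surj x
      refine ⟨fun i => q i + 1, ?_⟩
      rw [Part.mem_some_iff, eq_comm, Part.toOption_eq_some_iff]
      exact Part.mem_bind (Baire.minusOne_succ q) hq

end RepSpace

/-! ### Problems -/

/-- A problem: a partial multi-valued map between represented spaces. Its domain is the set of the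
points with a nonempty set of values. -/
structure Problem where
  source : RepSpace
  target : RepSpace
  val : source.carrier → Set target.carrier

namespace Problem

/-- The domain of a problem. -/
def dom (f : Problem) : Set f.source.carrier := {x | (f.val x).Nonempty}

/-- `F ⊢ f`: the partial function `F` is a realizer of `f`. -/
def Realizes (F : Baire →. Baire) (f : Problem) : Prop :=
  ∀ p, ∀ x ∈ f.source.rep p, x ∈ f.dom → ∃ q ∈ F p, ∃ y ∈ f.target.rep q, y ∈ f.val x

/-- Weihrauch reducibility of problems: there are computable `H, K` such that `H⟨id, GK⟩ ⊢ f` for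
every realizer `G ⊢ g`. -/
def LeW (f g : Problem) : Prop :=
  ∃ H K : Baire →. Baire, Baire.IsComputable H ∧ Baire.IsComputable K ∧
    ∀ G : Baire →. Baire, Realizes G g →
      Realizes (fun p => ((K p).bind G).bind fun r => H (Baire.pair p r)) f

/-- The identity of Baire space. -/
def one : Problem where
  source := RepSpace.baire
  target := RepSpace.baire
  val := fun p => {p}

/-- The nowhere defined problem on Baire space. -/
def zero : Problem where
  source := RepSpace.baire
  target := RepSpace.baire
  val := fun _ => ∅

/-- The coproduct `f ⊔ g`. -/
def coprod (f g : Problem) : Problem where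
  source := f.source.sum g.source
  target := f.target.sum g.target
  val := Sum.elim (fun x => Sum.inl '' f.val x) (fun u => Sum.inr '' g.val u)

/-- The meet `f ⊓ g`, with `(f ⊓ g)(x, u) = f(x) ⊔ g(u)` and `dom (f ⊓ g) = dom f × dom g`. -/
def meet (f g : Problem) : Problem where
  source := f.source.prod g.source
  target := f.target.sum g.target
  val := fun x =>
    {z | x.1 ∈ f.dom ∧ x.2 ∈ g.dom ∧ z ∈ Sum.inl '' f.val x.1 ∪ Sum.inr '' g.val x.2}

/-- The parallelization of `f`. -/
def parallelization (f : Problem) : Problem where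
  source := f.source.seq
  target := f.target.seq
  val := fun x => {y | ∀ n, y n ∈ f.val (x n)}

/-- The completion of `f`: it has the values of `f` on the domain of `f`, and all points of the
completed target space as values elsewhere. -/
noncomputable def completion (f : Problem) : Problem where
  source := f.source.completion
  target := f.target.completion
  val := fun x => {y | ∀ x', x = some x' → x' ∈ f.dom → ∃ y' ∈ f.val x', y = some y'}

/-- The realizer version `δ_Y⁻¹ ∘ f ∘ δ_X` of `f`, as a multi-valued map on Baire space. -/
def realizerVersion (f : Problem) (p : Baire) : Set Baire :=
  {r | ∃ x ∈ f.source.rep p, ∃ y ∈ f.target.rep r, y ∈ f.val x}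

/-- The problem `p ↦ {⟨n, k, q⟩ : ∅ ≠ φ_n⟨q, g^r ∘ φ_k (p)⟩ ⊆ f^r (p)}` on Baire space, where `g^r`
and `f^r` are the realizer versions. As for every composition of partial multi-valued maps,
the set `φ_n⟨q, g^r ∘ φ_k (p)⟩` is only defined if `s = φ_k (p)` exists, `g^r (s)` is nonempty, and
`φ_n⟨q, t⟩` exists for every `t ∈ g^r (s)`. The triple `⟨n, k, q⟩` is coded as the sequence `n k q`. -/
def mulImpCore (g f : Problem) : Problem where
  source := RepSpace.baire
  target := RepSpace.baire
  val := fun p => {z : Baire | ∃ (n k : ℕ) (q : Baire), z = Baire.cons n (Baire.cons k q) ∧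
    ∃ s ∈ Baire.phi k p, (g.realizerVersion s).Nonempty ∧
      ∀ t ∈ g.realizerVersion s, ∃ w ∈ Baire.phi n (Baire.pair q t), w ∈ f.realizerVersion p}

end Problem

/-! ### Problems including the additional top element -/

/-- The problems together with an additional element `∞`. -/
inductive ExtProblem where
  | of (f : Problem)
  | infty

namespace ExtProblem

/-- Weihrauch reducibility, with `∞` as an additional top element. -/
def LeW : ExtProblem → ExtProblem → Prop
  | _, infty => True
  | infty, of _ => False
  | of f, of g => f.LeW g

/-- The completion, with `∞` as the completion of `∞`. -/
noncomputable def completion : ExtProblem → ExtProblem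
  | of f => of f.completion
  | infty => infty

/-- The parallelization, with `∞` as the parallelization of `∞`. -/
def parallelization : ExtProblem → ExtProblem
  | of f => of f.parallelization
  | infty => infty

/-- The coproduct, with `f ⊔ ∞ = ∞ ⊔ f = ∞`. -/
def coprod : ExtProblem → ExtProblem → ExtProblem
  | of f, of g => of (f.coprod g)
  | _, _ => infty

/-- The meet, with `f ⊓ ∞ = ∞ ⊓ f = f`. -/
def meet : ExtProblem → ExtProblem → ExtProblem
  | of f, of g => of (f.meet g)
  | f, infty => f
  | infty, g => g

open Classical in
/-- The multiplicative implication `g ↠ f` (with `g` as the first argument). -/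
noncomputable def mulImp : ExtProblem → ExtProblem → ExtProblem
  | infty, _ => of Problem.zero
  | of _, infty => infty
  | of g, of f => if g.dom.Nonempty ∨ f.dom = ∅ then of (g.mulImpCore f) else infty

/-- The parallelization of the completion. -/
noncomputable def parCompl (f : ExtProblem) : ExtProblem := f.completion.parallelization

/-- Parallelized total Weihrauch reducibility. -/
def LePtW (f g : ExtProblem) : Prop := f.LeW g.parCompl

/-- Parallelized total Weihrauch equivalence. -/
def EquivPtW (f g : ExtProblem) : Prop := f.LePtW g ∧ g.LePtW f

/-- The parallelized completion of `⊓`. -/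
noncomputable def parComplMeet (f g : ExtProblem) : ExtProblem := f.parCompl.meet g.parCompl

/-- The parallelized completion of `↠` (with `g` as the first argument). -/
noncomputable def parComplMulImp (g f : ExtProblem) : ExtProblem := g.parCompl.mulImp f.parCompl

end ExtProblem

/-! ### Degrees -/

/-- The parallelized total Weihrauch degrees including `∞`: the equivalence classes with respect to
parallelized total Weihrauch equivalence. -/
def PtWDegree : Type 1 := {D : Set ExtProblem // ∃ f, D = {h | h.EquivPtW f}}

namespace PtWDegree

/-- The degree of a problem. -/
def deg (f : ExtProblem) : PtWDegree := ⟨{h | h.EquivPtW f}, f, rfl⟩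

/-- The order on degrees that is induced by reducibility of representatives. -/
def Le (D E : PtWDegree) : Prop := ∃ f ∈ D.1, ∃ g ∈ E.1, f.LePtW g

end PtWDegree

/-! ### Algebras -/

/-- `(X, ≤, ∧, ∨, ·, →, 1, ⊥, ⊤)` is a Weihrauch algebra. -/
structure IsWeihrauchAlgebra {X : Type*} (le : X → X → Prop) (inf sup mul imp : X → X → X)
    (one bot top : X) : Prop where
  le_refl : ∀ x, le x x
  le_trans : ∀ x y z, le x y → le y z → le x z
  le_antisymm : ∀ x y, le x y → le y x → x = y
  inf_le_left : ∀ x y, le (inf x y) x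
  inf_le_right : ∀ x y, le (inf x y) y
  le_inf : ∀ x y z, le z x → le z y → le z (inf x y)
  le_sup_left : ∀ x y, le x (sup x y)
  le_sup_right : ∀ x y, le y (sup x y)
  sup_le : ∀ x y z, le x z → le y z → le (sup x y) z
  bot_le : ∀ x, le bot x
  le_top : ∀ x, le x top
  mul_assoc : ∀ x y z, mul (mul x y) z = mul x (mul y z)
  one_mul : ∀ x, mul one x = x
  mul_one : ∀ x, mul x one = x
  mul_mono : ∀ x x' y y', le x x' → le y y' → le (mul x y) (mul x' y')
  imp_mono : ∀ x x' y y', le x' x → le y y' → le (imp x y) (imp x' y')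
  imp_le : ∀ x y z, le x (mul y z) → le (imp y x) z

/-- A Troelstra algebra is a commutative and deductive Weihrauch algebra. -/
structure IsTroelstraAlgebra {X : Type*} (le : X → X → Prop) (inf sup mul imp : X → X → X)
    (one bot top : X) : Prop extends IsWeihrauchAlgebra le inf sup mul imp one bot top where
  mul_comm : ∀ x y, mul x y = mul y x
  deductive : ∀ x y z, le x (mul y z) ↔ le (imp y x) z

/-- A Brouwer algebra `(X, ≤, ∧, ∨, →, ⊥, ⊤)` is a Troelstra algebra whose monoid operation is `∨`,
with neutral element `⊥`. -/
def IsBrouwerAlgebra {X : Type*} (le : X → X → Prop) (inf sup imp : X → X → X)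
    (bot top : X) : Prop :=
  IsTroelstraAlgebra le inf sup sup imp bot bot top

/-! A problem enters Weihrauch reducibility only through its realizer version, a multi-valued map on
Baire space, and reducibility becomes the pointwise relation `Reduces` (`Problem.leW_iff`). The
parallelized completion turns into `totalPower`. This map has a value everywhere: it receives a
sequence of delayed names and owes an answer only in those components that name a point of the
domain. Countably many questions can therefore be asked at once, and questions whose computation
diverges do no harm: `exists_totalization` replaces a partial computation by a total one that writes
zeros while it waits.

With this, `totalPower` is a closure operator (`totalPower_self`, `totalPower_of`), which gives the
preorder. Meets and joins come from tagged answers and tagged questions.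

The heart is the deduction property, `f ≤ g ⊔ h` iff `(g ⇛ f) ≤ h`. From left to right
(`impMap_of_sumMap`), the questions to `g` and to `h` are computed from the input, so the answers of
`h` can be stored in `q`, leaving those of `g` to be consulted later. From right to left
(`sumMap_of_impMap`), `h` yields `⟨n, k, q⟩` and only then is the question `φ_k(p)` to `g` known,
whereas `⊔` must receive all questions in advance. So `φ_k(p)` is asked for all `k` simultaneously,
and the answer for the right `k` is selected afterwards. Parallelization permits infinitely many
questions, completion permits the undefined ones.

Computability proofs use primitive recursive approximations on finite prefixes, never wrong and
eventually always defined; the closure properties of such approximations replace work with machine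
codes. -/

/-! ### Computable relations between sequences and values -/

namespace Baire

open Filter

variable {α β γ : Type} [Primcodable α] [Primcodable β] [Primcodable γ]

/-- The list `[p 0, …, p (j-1)]`. -/
def take (p : Baire) (j : ℕ) : List ℕ := (List.range j).map p

@[simp] theorem length_take (p : Baire) (j : ℕ) : (take p j).length = j := by simp [take]

theorem getElem?_take_of_lt (p : Baire) {m j : ℕ} (h : m < j) : (take p j)[m]? = some (p m) := by
  simp [take, h]

@[simp] theorem getElem_take (p : Baire) {m j : ℕ} (h : m < (take p j).length) :
    (take p j)[m] = p m := by
  simp [take]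

theorem take_take (p : Baire) {m j : ℕ} (h : m ≤ j) : (take p j).take m = take p m := by
  simp [take, ← List.map_take, List.take_range, h]

theorem take_succ (p : Baire) (j : ℕ) : take p (j + 1) = take p j ++ [p j] := by
  simp [take, List.range_succ]

theorem encode_take (p : Baire) (j : ℕ) : Encodable.encode (take p j) = initSeg p j := rfl

/-- `a` approximates `v` on `p`: evaluated on finite prefixes of `p`, it never gives a value
different from `v`, and it gives the value `v` on all sufficiently long prefixes. -/
def Approximates (a : List ℕ → Option β) (p : Baire) (v : β) : Prop :=
  (∀ j w, a (take p j) = some w → w = v) ∧ ∀ᶠ j in atTop, a (take p j) = some v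

/-- The values `v` with `R x p v` are computable from `x` and from prefixes of `p`. -/
def ValueComputable (R : α → Baire → β → Prop) : Prop :=
  ∃ a : α → List ℕ → Option β, Primrec₂ a ∧ ∀ x p v, R x p v → Approximates (a x) p v

/-- The sequences `q` with `R x p q` are computable from `x` and `p`. -/
def RelComputable (R : α → Baire → Baire → Prop) : Prop :=
  ValueComputable fun (x : α × ℕ) p v => ∃ q, R x.1 p q ∧ v = q x.2

/-- The first value different from `some 0` in a list. -/
def firstNonzero (l : List (Option ℕ)) : Option ℕ :=
  l.foldr (fun o s => if o = some 0 then s else o) none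

theorem firstNonzero_cons (o : Option ℕ) (l : List (Option ℕ)) :
    firstNonzero (o :: l) = if o = some 0 then firstNonzero l else o := rfl

theorem primrec_firstNonzero : Primrec firstNonzero :=
  Primrec.list_foldr (h := fun _ y => if y.1 = some 0 then y.2 else y.1) .id (Primrec.const none)
    (Primrec.ite (Primrec.eq.comp (Primrec.fst.comp .snd) (Primrec.const (some 0)))
      (Primrec.snd.comp .snd) (Primrec.fst.comp .snd))

theorem firstNonzero_append_of_zero {l : List (Option ℕ)} (h : ∀ o ∈ l, o = some 0)
    (l' : List (Option ℕ)) : firstNonzero (l ++ l') = firstNonzero l' := by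
  induction l with
  | nil => rfl
  | cons o l ih =>
    rw [List.cons_append, firstNonzero_cons, if_pos (h o (by simp)), ih fun o ho => h o (by simp [ho])]

/-- An undecided entry stops the search with `none` instead of being skipped, so a later nonzero
value is never reported prematurely. -/
theorem firstNonzero_append {l : List (Option ℕ)} (h : ∀ o ∈ l, ∀ w, o = some w → w = 0)
    (l' : List (Option ℕ)) :
    firstNonzero (l ++ l') = none ∨ firstNonzero (l ++ l') = firstNonzero l' := by
  induction l with
  | nil => exact Or.inr rfl
  | cons o l ih =>
    rw [List.cons_append, firstNonzero_cons]
    split_ifs with ho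
    · exact ih fun o ho => h o (by simp [ho])
    · left
      cases o with
      | none => rfl
      | some w => exact absurd (by rw [h _ (by simp) w rfl]) ho

/-! ### Closure properties of computable values -/

namespace ValueComputable

theorem mono {R S : α → Baire → β → Prop} (hS : ValueComputable S)
    (h : ∀ x p v, R x p v → S x p v) : ValueComputable R := by
  obtain ⟨a, ha, haS⟩ := hS
  exact ⟨a, ha, fun x p v hv => haS x p v (h x p v hv)⟩

theorem comp_param {R : α → Baire → β → Prop} (hR : ValueComputable R) {e : γ → α}
    (he : Primrec e) : ValueComputable fun x => R (e x) := by
  obtain ⟨a, ha, haR⟩ := hR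
  exact ⟨fun x => a (e x), ha.comp (he.comp .fst) .snd, fun x => haR (e x)⟩

theorem prefix_map {g : α → List ℕ → β} (hg : Primrec₂ g) {e : α → ℕ} (he : Primrec e) :
    ValueComputable fun x p v => v = g x (take p (e x)) := by
  refine ⟨fun x l => if e x ≤ l.length then some (g x (l.take (e x))) else none, ?_, ?_⟩
  · exact Primrec.ite (Primrec.nat_le.comp (he.comp .fst) (Primrec.list_length.comp .snd))
      (Primrec.option_some.comp (hg.comp .fst (Primrec.list_take.comp (he.comp .fst) .snd)))
      (Primrec.const none)
  · rintro x p v rfl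
    refine ⟨fun j w h => ?_, ?_⟩
    · simp only [length_take] at h
      split_ifs at h with hj
      rw [take_take p hj] at h
      exact (Option.some.inj h).symm
    · filter_upwards [eventually_ge_atTop (e x)] with j hj
      simp [hj, take_take p hj]

theorem digit {e : α → ℕ} (he : Primrec e) :
    ValueComputable fun x (p : Baire) v => v = p (e x) := by
  have hg : Primrec₂ fun (x : α) (l : List ℕ) => l.getD (e x) 0 :=
    (Primrec.list_getD 0).comp .snd (he.comp .fst)
  refine (prefix_map hg (Primrec.succ.comp he)).mono ?_
  rintro x p v rfl
  simp

theorem bind {R : α → Baire → β → Prop} {S : α × β → Baire → γ → Prop} (hR : ValueComputable R)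
    (hS : ValueComputable S) :
    ValueComputable fun x p v => ∃ b, R x p b ∧ S (x, b) p v := by
  obtain ⟨a, ha, haR⟩ := hR
  obtain ⟨c, hc, hcS⟩ := hS
  refine ⟨fun x l => (a x l).bind fun b => c (x, b) l, ?_, ?_⟩
  · exact Primrec.option_bind ha
      (hc.comp (Primrec.pair (Primrec.fst.comp .fst) .snd) (Primrec.snd.comp .fst))
  · rintro x p v ⟨b, hb, hv⟩
    obtain ⟨h1, h2⟩ := haR x p b hb
    obtain ⟨h3, h4⟩ := hcS (x, b) p v hv
    refine ⟨fun j w h => ?_, ?_⟩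
    · obtain ⟨b', hb', hw⟩ := Option.bind_eq_some_iff.1 h
      obtain rfl := h1 j b' hb'
      exact h3 j w hw
    · filter_upwards [h2, h4] with j hj hj'
      simp [hj, hj']

theorem ite {P : α → Prop} [DecidablePred P] (hP : PrimrecPred P) {R S : α → Baire → β → Prop}
    (hR : ValueComputable R) (hS : ValueComputable S) :
    ValueComputable fun x p v => if P x then R x p v else S x p v := by
  obtain ⟨a, ha, haR⟩ := hR
  obtain ⟨c, hc, hcS⟩ := hS
  refine ⟨fun x l => if P x then a x l else c x l, Primrec.ite (hP.comp .fst) ha hc, ?_⟩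
  intro x p v h
  by_cases hx : P x
  · simp only [hx, if_true] at h ⊢
    exact haR x p v h
  · simp only [hx, if_false] at h ⊢
    exact hcS x p v h

/-- Search for the first nonzero value. -/
theorem find {R : α × ℕ → Baire → ℕ → Prop} (hR : ValueComputable R) :
    ValueComputable fun x p v => ∃ j, R (x, j) p (v + 1) ∧ ∀ i < j, R (x, i) p 0 := by
  obtain ⟨a, ha, haR⟩ := hR
  -- The length of the prefix also bounds the search; `Nat.pred` undoes the shift in `v + 1`.
  refine ⟨fun x l =>
    (firstNonzero ((List.range l.length).map fun j => a (x, j) l)).map Nat.pred, ?_, ?_⟩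
  · exact Primrec.option_map (primrec_firstNonzero.comp (Primrec.list_map
      (Primrec.list_range.comp (Primrec.list_length.comp .snd)) (ha.comp (Primrec.pair
        (Primrec.fst.comp .fst) .snd) (Primrec.snd.comp .fst)).to₂)) (Primrec.pred.comp .snd)
  · rintro x p v ⟨j, hj, hi⟩
    obtain ⟨hj1, hj2⟩ := haR (x, j) p _ hj
    have split : ∀ L, j < L → ∃ l', (List.range L).map (fun i => a (x, i) (take p L)) =
        (List.range j).map (fun i => a (x, i) (take p L)) ++ a (x, j) (take p L) :: l' := by
      intro L hL
      obtain ⟨d, rfl⟩ := Nat.exists_eq_add_of_lt hL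
      rw [add_assoc, List.range_add, List.map_append, List.range_succ_eq_map]
      exact ⟨_, by simp only [List.map_cons, add_zero]; rfl⟩
    refine ⟨fun L w h => ?_, ?_⟩
    · obtain ⟨u, hu, rfl⟩ := Option.map_eq_some_iff.1 h
      rw [length_take] at hu
      have hz : ∀ K ≤ j, ∀ o ∈ (List.range K).map (fun i => a (x, i) (take p L)),
          ∀ w, o = some w → w = 0 := by
        intro K hK o ho w hw
        obtain ⟨i, hi', rfl⟩ := List.mem_map.1 ho
        exact (haR (x, i) p 0 (hi i ((List.mem_range.1 hi').trans_le hK))).1 L w hw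
      rcases lt_or_ge j L with hL | hL
      · obtain ⟨l', hl'⟩ := split L hL
        rw [hl'] at hu
        rcases firstNonzero_append (hz j le_rfl) (a (x, j) (take p L) :: l') with h0 | h0
        · rw [h0] at hu; cases hu
        · rw [h0, firstNonzero_cons] at hu
          split_ifs at hu with hc
          · exact absurd (hj1 L 0 hc) (by omega)
          · rw [hj1 L u hu]; rfl
      · rcases firstNonzero_append (hz L hL) [] with h0 | h0 <;>
          rw [List.append_nil] at h0 <;> rw [h0] at hu <;> cases hu
    · have hall : ∀ᶠ L in atTop, ∀ i ∈ Set.Iio j, a (x, i) (take p L) = some 0 :=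
        (eventually_all_finite (Set.finite_Iio j)).2 fun i hi' => (haR (x, i) p 0 (hi i hi')).2
      filter_upwards [hall, hj2, eventually_gt_atTop j] with L h1 h2 h3
      obtain ⟨l', hl'⟩ := split L h3
      rw [length_take, hl', firstNonzero_append_of_zero, firstNonzero_cons, h2]
      · simp
      · intro o ho
        obtain ⟨i, hi', rfl⟩ := List.mem_map.1 ho
        exact h1 i (List.mem_range.1 hi')

end ValueComputable

/-! ### The Gödel numbering in terms of its digits -/

theorem valueComputable_query :
    ValueComputable fun (x : (ℕ × ℕ) × ℕ) p v => v ∈ query x.1.1 p x.1.2 x.2 := by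
  -- The prefix length doubles as the step bound of `evaln`, which makes the approximation primitive
  -- recursive.
  refine ⟨fun x l => if x.2 ≤ l.length then Nat.Partrec.Code.evaln l.length
    (Denumerable.ofNat Nat.Partrec.Code x.1.1)
    (Nat.pair x.1.2 (Encodable.encode (l.take x.2))) else none, ?_, ?_⟩
  · refine Primrec.ite (Primrec.nat_le.comp (Primrec.snd.comp .fst)
      (Primrec.list_length.comp .snd)) ?_ (Primrec.const none)
    refine Nat.Partrec.Code.primrec_evaln.comp (Primrec.pair (Primrec.pair
      (Primrec.list_length.comp .snd) ((Primrec.ofNat _).comp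
        (Primrec.fst.comp (Primrec.fst.comp .fst)))) ?_)
    exact Primrec₂.natPair.comp (Primrec.snd.comp (Primrec.fst.comp .fst))
      (Primrec.encode.comp (Primrec.list_take.comp (Primrec.snd.comp .fst) .snd))
  · rintro ⟨⟨n, m⟩, j⟩ p v hv
    refine ⟨fun L w h => ?_, ?_⟩
    · simp only [length_take] at h
      split_ifs at h with hj
      rw [take_take p hj, encode_take] at h
      exact Part.mem_unique (Nat.Partrec.Code.evaln_sound h) hv
    · obtain ⟨k, hk⟩ := Nat.Partrec.Code.evaln_complete.1 hv
      filter_upwards [eventually_ge_atTop j, eventually_ge_atTop k] with L hj hk'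
      simp only [length_take, hj, if_true, take_take p hj, encode_take]
      exact Nat.Partrec.Code.evaln_mono hk' hk

theorem mem_phiDigit {n m v : ℕ} {p : Baire} :
    v ∈ phiDigit n p m ↔ ∃ j, v + 1 ∈ query n p m j ∧ ∀ i < j, 0 ∈ query n p m i := by
  unfold phiDigit
  rw [Part.mem_bind_iff]
  constructor
  · rintro ⟨j, hj, hb⟩
    obtain ⟨h1, h2⟩ := Nat.mem_rfind.1 hj
    obtain ⟨a, ha, ha0⟩ := (Part.mem_map_iff _).1 h1
    obtain ⟨b, hb', rfl⟩ := (Part.mem_map_iff _).1 hb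
    obtain rfl := Part.mem_unique ha hb'
    refine ⟨j, ?_, fun i hi => ?_⟩
    · rwa [← Nat.succ_eq_add_one, Nat.succ_pred_eq_of_ne_zero (of_decide_eq_true ha0)]
    · obtain ⟨c, hc, hc0⟩ := (Part.mem_map_iff _).1 (h2 hi)
      rwa [← not_not.1 (of_decide_eq_false hc0)]
  · rintro ⟨j, hj, h⟩
    exact ⟨j, Nat.mem_rfind.2 ⟨(Part.mem_map_iff _).2 ⟨_, hj, by simp⟩,
      fun {i} hi => (Part.mem_map_iff _).2 ⟨0, h i hi, by simp⟩⟩,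
      (Part.mem_map_iff _).2 ⟨_, hj, rfl⟩⟩

theorem mem_phi {n : ℕ} {p q : Baire} : q ∈ phi n p ↔ ∀ m, q m ∈ phiDigit n p m := by
  constructor
  · rintro ⟨h, rfl⟩ m
    exact Part.get_mem (h m)
  · intro h
    exact ⟨fun m => (h m).1, funext fun m => (h m).2⟩

/-! ### Closure properties of computable relations on Baire space -/

namespace RelComputable

theorem mono {R S : α → Baire → Baire → Prop} (hS : RelComputable S)
    (h : ∀ x p q, R x p q → S x p q) : RelComputable R :=
  ValueComputable.mono hS fun x p _ ⟨q, hq, hv⟩ => ⟨q, h x.1 p q hq, hv⟩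

theorem comp_param {R : α → Baire → Baire → Prop} (hR : RelComputable R) {e : γ → α}
    (he : Primrec e) : RelComputable fun x => R (e x) :=
  ValueComputable.comp_param (e := fun x : γ × ℕ => (e x.1, x.2)) hR
    (Primrec.pair (he.comp .fst) .snd)

theorem phi : RelComputable fun n p q => q ∈ phi n p := by
  refine valueComputable_query.find.mono ?_
  rintro ⟨n, m⟩ p _ ⟨q, hq, rfl⟩
  exact mem_phiDigit.1 (mem_phi.1 hq m)

/-- Every computable relation is contained in the graph of some `φ n`. -/
theorem exists_phi {R : α → Baire → Baire → Prop} (hR : RelComputable R) (x : α) :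
    ∃ n, ∀ p q, R x p q → q ∈ Baire.phi n p := by
  obtain ⟨a, ha, haR⟩ := hR
  -- The protocol of `query`: `0` for an undecided digit, `w + 1` for the digit `w`.
  have hf : Primrec fun z : ℕ => Option.casesOn (motive := fun _ => ℕ)
      (a (x, z.unpair.1) (Denumerable.ofNat (List ℕ) z.unpair.2)) 0 Nat.succ := by
    refine Primrec.option_casesOn (ha.comp (Primrec.pair (Primrec.const x)
      (Primrec.fst.comp .unpair)) ((Primrec.ofNat _).comp (Primrec.snd.comp .unpair)))
      (Primrec.const 0) (Primrec.succ.comp .snd)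
  obtain ⟨c, hc⟩ := Nat.Partrec.Code.exists_code.1 (Nat.Partrec.of_primrec (Primrec.nat_iff.1 hf))
  refine ⟨Encodable.encode c, fun p q hq => mem_phi.2 fun m => mem_phiDigit.2 ?_⟩
  have hquery : ∀ j, query (Encodable.encode c) p m j =
      Part.some (Option.casesOn (motive := fun _ => ℕ) (a (x, m) (take p j)) 0 Nat.succ) := by
    intro j
    simp [query, hc, ← encode_take]
  obtain ⟨h1, h2⟩ := haR (x, m) p (q m) ⟨q, hq, rfl⟩
  have hex : ∃ j, a (x, m) (take p j) ≠ none := by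
    obtain ⟨j, hj⟩ := h2.exists
    exact ⟨j, by simp [hj]⟩
  classical
  refine ⟨Nat.find hex, ?_, fun i hi => ?_⟩
  · obtain ⟨w, hw⟩ := Option.ne_none_iff_exists'.1 (Nat.find_spec hex)
    rw [hquery, hw, h1 _ w hw]
    exact Part.mem_some _
  · rw [hquery, not_not.1 (Nat.find_min hex hi)]
    exact Part.mem_some _

theorem id : RelComputable fun (_ : α) p q => q = p :=
  (ValueComputable.digit Primrec.snd).mono fun _ _ _ ⟨_, h, hv⟩ => by rw [hv, h]

theorem reindex {e : α → ℕ → ℕ} (he : Primrec₂ e) :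
    RelComputable fun x p q => q = fun m => p (e x m) :=
  (ValueComputable.digit he).mono fun _ _ _ ⟨_, h, hv⟩ => by rw [hv, h]

theorem cons {c : α → ℕ} (hc : Primrec c) : RelComputable fun x p q => q = cons (c x) p := by
  refine (ValueComputable.prefix_map (g := fun (x : α × ℕ) l => (c x.1 :: l).getD x.2 0)
    (e := Prod.snd) ?_ .snd).mono ?_
  · exact (Primrec.list_getD 0).comp (Primrec.list_cons.comp
      (hc.comp (Primrec.fst.comp .fst)) .snd) (Primrec.snd.comp .fst)
  · rintro ⟨x, m⟩ p _ ⟨q, rfl, rfl⟩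
    cases m with
    | zero => simp [Baire.cons]
    | succ m =>
      simp [Baire.cons]

theorem pair {R S : α → Baire → Baire → Prop} (hR : RelComputable R) (hS : RelComputable S) :
    RelComputable fun x p r => ∃ u v, R x p u ∧ S x p v ∧ r = pair u v := by
  have he : Primrec fun x : α × ℕ => (x.1, x.2 / 2) :=
    Primrec.pair .fst (Primrec.nat_div.comp .snd (Primrec.const 2))
  have hP : PrimrecPred fun x : α × ℕ => x.2 % 2 = 0 :=
    Primrec.eq.comp (Primrec.nat_mod.comp .snd (Primrec.const 2)) (Primrec.const 0)
  refine (ValueComputable.ite hP (ValueComputable.comp_param hR he)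
    (ValueComputable.comp_param hS he)).mono ?_
  rintro ⟨x, m⟩ p _ ⟨_, ⟨u, v, hu, hv, rfl⟩, rfl⟩
  by_cases hm : m % 2 = 0
  · simpa only [hm, if_true, Baire.pair] using ⟨u, hu, rfl⟩
  · simpa only [hm, if_false, Baire.pair] using ⟨v, hv, rfl⟩

theorem ite {P : α → Prop} [DecidablePred P] (hP : PrimrecPred P) {R S : α → Baire → Baire → Prop}
    (hR : RelComputable R) (hS : RelComputable S) :
    RelComputable fun x p q => if P x then R x p q else S x p q := by
  refine (ValueComputable.ite (P := fun x : α × ℕ => P x.1) (hP.comp .fst) hR hS).mono ?_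
  rintro x p v ⟨q, h, rfl⟩
  split_ifs at h ⊢ <;> exact ⟨q, h, rfl⟩

/-- Makes a digit of the input a parameter of the computation; this is how tags and Gödel numbers
contained in a sequence take effect. -/
theorem branch {R : α × ℕ → Baire → Baire → Prop} (hR : RelComputable R) {e : α → ℕ}
    (he : Primrec e) : RelComputable fun x p q => R (x, p (e x)) p q := by
  have hR' : ValueComputable fun (y : (α × ℕ) × ℕ) p v => ∃ q, R (y.1.1, y.2) p q ∧ v = q y.1.2 :=
    ValueComputable.comp_param (e := fun y : (α × ℕ) × ℕ => ((y.1.1, y.2), y.1.2)) hR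
      (Primrec.pair (Primrec.pair (Primrec.fst.comp .fst) .snd) (Primrec.snd.comp .fst))
  refine ((ValueComputable.digit (he.comp .fst)).bind hR').mono ?_
  rintro ⟨x, m⟩ p _ ⟨q, hq, rfl⟩
  exact ⟨_, rfl, q, hq, rfl⟩

theorem minusOne : RelComputable fun (_ : α) p q => q ∈ minusOne p := by
  -- `g` is nonzero only at the position of the nonzero entry number `m`. The search of `find` stops
  -- there, and its shift by one is the decrease in `p - 1`.
  let g : (α × ℕ) × ℕ → List ℕ → ℕ := fun y l =>
    if ((l.take y.2).filter fun v => decide (v ≠ 0)).length = y.1.2 then l.getD y.2 0 else 0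
  have hne : PrimrecPred fun v : ℕ => v ≠ 0 :=
    PrimrecPred.not (Primrec.eq.comp .id (Primrec.const 0))
  have hg : Primrec₂ g := by
    refine Primrec.ite (Primrec.eq.comp (Primrec.list_length.comp ((Primrec.listFilter hne).comp
      (Primrec.list_take.comp (Primrec.snd.comp .fst) .snd)))
      (Primrec.snd.comp (Primrec.fst.comp .fst))) ((Primrec.list_getD 0).comp .snd
        (Primrec.snd.comp .fst)) (Primrec.const 0)
  refine (ValueComputable.prefix_map hg (Primrec.succ.comp .snd)).find.mono ?_
  rintro ⟨x, m⟩ p _ ⟨q, ⟨hinf, rfl⟩, rfl⟩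
  have hcount : ∀ i, ((take p i).filter fun v => decide (v ≠ 0)).length =
      Nat.count (fun i => p i ≠ 0) i := by
    intro i
    induction i with
    | zero => simp [take]
    | succ i ih =>
      rw [take_succ, List.filter_append, List.length_append, ih, Nat.count_succ]
      by_cases h : p i = 0 <;> simp [h]
  have hgi : ∀ i, g ((x, m), i) (take p (i + 1)) =
      if Nat.count (fun i => p i ≠ 0) i = m then p i else 0 := by
    intro i
    simp only [g, take_take p (Nat.le_succ i), hcount, List.getD_eq_getElem?_getD,
      getElem?_take_of_lt p (Nat.lt_succ_self i), Option.getD_some]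
  refine ⟨Nat.nth (fun i => p i ≠ 0) m, ?_, fun i hi => ?_⟩
  · have := Nat.nth_mem_of_infinite hinf m
    simp only [hgi, Nat.succ_eq_add_one, Nat.count_nth_of_infinite hinf, if_true, Baire.minusOne]
    omega
  · simp only [hgi, Nat.succ_eq_add_one]
    split_ifs with h
    · by_contra h0
      have := Nat.nth_count (p := fun i => p i ≠ 0) (Ne.symm h0)
      rw [h] at this
      exact absurd this hi.ne'
    · rfl

/-- The digits found by an approximation `a`, in the order of their positions. -/
def digits (a : ℕ → Option ℕ) (n : ℕ) : List ℕ :=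
  Nat.rec [] (fun _ l => l ++ (a l.length).toList) n

theorem digits_eq_take {a : ℕ → Option ℕ} {q : Baire} (h : ∀ m w, a m = some w → w = q m) (n : ℕ) :
    ∃ i, digits a n = take q i := by
  induction n with
  | zero => exact ⟨0, rfl⟩
  | succ n ih =>
    obtain ⟨i, hi⟩ := ih
    have hs : digits a (n + 1) = digits a n ++ (a (digits a n).length).toList := rfl
    rw [hs, hi, length_take]
    cases ha : a i with
    | none => exact ⟨i, by simp⟩
    | some w => exact ⟨i + 1, by rw [take_succ, h i w ha]; rfl⟩

/-- A round stalls only at an unknown digit, hence not before length `N`. -/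
theorem le_length_digits {a : ℕ → Option ℕ} {N : ℕ} (h : ∀ m < N, (a m).isSome) (n : ℕ) :
    min n N ≤ (digits a n).length := by
  induction n with
  | zero => simp
  | succ n ih =>
    have hs : digits a (n + 1) = digits a n ++ (a (digits a n).length).toList := rfl
    rw [hs, List.length_append]
    by_cases hN : (digits a n).length < N
    · obtain ⟨w, hw⟩ := Option.isSome_iff_exists.1 (h _ hN)
      rw [hw, Option.toList_some, List.length_singleton]
      omega
    · omega

/-- A prefix of `p` determines a prefix of the intermediate `q`, namely the consecutive digits
already known. It is always correct and its length tends to infinity, so the approximation for `S`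
can be run on it. -/
theorem comp_value {R : α → Baire → Baire → Prop} {S : α → Baire → β → Prop}
    (hR : RelComputable R) (hS : ValueComputable S) :
    ValueComputable fun x p v => ∃ q, R x p q ∧ S x q v := by
  obtain ⟨a, ha, haR⟩ := hR
  obtain ⟨c, hc, hcS⟩ := hS
  refine ⟨fun x l => c x (digits (fun m => a (x, m) l) l.length), ?_, ?_⟩
  · refine hc.comp .fst (Primrec.nat_rec' (h := fun (z : α × List ℕ) (y : ℕ × List ℕ) =>
      y.2 ++ (a (z.1, y.2.length) z.2).toList) (Primrec.list_length.comp .snd)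
      (Primrec.const []) ?_)
    refine Primrec.list_append.comp (Primrec.snd.comp .snd) (Primrec.optionToList.comp
      (ha.comp (Primrec.pair (Primrec.fst.comp .fst) (Primrec.list_length.comp
        (Primrec.snd.comp .snd))) (Primrec.snd.comp .fst)))
  · rintro x p v ⟨q, hq, hv⟩
    have hd : ∀ m, Approximates (a (x, m)) p (q m) := fun m => haR (x, m) p _ ⟨q, hq, rfl⟩
    have hpre : ∀ j, ∃ i, digits (fun m => a (x, m) (take p j)) (take p j).length = take q i :=
      fun j => digits_eq_take (fun m w hw => (hd m).1 j w hw) _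
    obtain ⟨h1, h2⟩ := hcS x q v hv
    refine ⟨fun j w hw => ?_, ?_⟩
    · obtain ⟨i, hi⟩ := hpre j
      simp only [hi] at hw
      exact h1 i w hw
    · obtain ⟨N, hN⟩ := eventually_atTop.1 h2
      have hall : ∀ᶠ j in atTop, ∀ m ∈ Set.Iio N, a (x, m) (take p j) = some (q m) :=
        (eventually_all_finite (Set.finite_Iio N)).2 fun m _ => (hd m).2
      filter_upwards [hall, eventually_ge_atTop N] with j hj hjN
      obtain ⟨i, hi⟩ := hpre j
      have hle := le_length_digits (a := fun m => a (x, m) (take p j)) (N := N)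
        (fun m hm => by simp [hj m hm]) (take p j).length
      rw [hi, length_take, length_take, min_eq_right hjN] at hle
      simp only [hi]
      exact hN i hle

theorem comp {R S : α → Baire → Baire → Prop} (hR : RelComputable R) (hS : RelComputable S) :
    RelComputable fun x p r => ∃ q, R x p q ∧ S x q r := by
  refine ((hR.comp_param Primrec.fst).comp_value hS).mono ?_
  rintro ⟨x, m⟩ p _ ⟨r, ⟨q, hq, hr⟩, rfl⟩
  exact ⟨q, hq, r, hr, rfl⟩

/-- Composition that keeps the input available for the second relation. -/
theorem comp_pair {R S : α → Baire → Baire → Prop} (hR : RelComputable R)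
    (hS : RelComputable S) : RelComputable fun x p r => ∃ q, R x p q ∧ S x (Baire.pair p q) r :=
  ((id.pair hR).comp hS).mono fun _ p _ ⟨q, hq, hr⟩ => ⟨_, ⟨p, q, rfl, hq, rfl⟩, hr⟩

end RelComputable

end Baire

/-! ### Total names of partially computable points -/

namespace Baire

open Filter

/-- The number of digits that `b` has produced after `m` steps, where in step `i` the prefix of
length `i` of `l` is used for the next digit. -/
def emitted (b : ℕ → List ℕ → Option ℕ) (l : List ℕ) (m : ℕ) : ℕ :=
  Nat.rec 0 (fun i c => c + if (b c (l.take i)).isSome then 1 else 0) m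

/-- The sequence of the digits produced by `b`, increased by one, with zeros for the steps without
a digit. -/
def delay (b : ℕ → List ℕ → Option ℕ) (p : Baire) : Baire := fun m =>
  Option.casesOn (motive := fun _ => ℕ) (b (emitted b (take p m) m) (take p m)) 0 Nat.succ

theorem emitted_take (b : ℕ → List ℕ → Option ℕ) (p : Baire) {m M : ℕ} (h : m ≤ M) :
    emitted b (take p M) m = Nat.count (fun i => delay b p i ≠ 0) m := by
  induction m generalizing M with
  | zero => simp [emitted]
  | succ m ih =>
    have hs : emitted b (take p M) (m + 1) = emitted b (take p M) m +
      if (b (emitted b (take p M) m) ((take p M).take m)).isSome then 1 else 0 := rfl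
    rw [hs, take_take p (Nat.le_of_succ_le h), ih (Nat.le_of_succ_le h), Nat.count_succ]
    congr 1
    have hd : delay b p m = Option.casesOn (motive := fun _ => ℕ)
      (b (emitted b (take p m) m) (take p m)) 0 Nat.succ := rfl
    rw [ih le_rfl] at hd
    rw [hd]
    cases b (Nat.count (fun i => delay b p i ≠ 0) m) (take p m) <;> simp

/-- Waiting for a digit never lasts forever, because its approximation is eventually defined for
good. Thus infinitely many nonzero entries appear, in the right order and with correct values. -/
theorem mem_minusOne_delay {b : ℕ → List ℕ → Option ℕ} {p q : Baire}
    (h : ∀ n, Approximates (b n) p (q n)) : q ∈ minusOne (delay b p) := by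
  set P : ℕ → Prop := fun i => delay b p i ≠ 0
  have hd : ∀ m, delay b p m = Option.casesOn (motive := fun _ => ℕ)
      (b (Nat.count P m) (take p m)) 0 Nat.succ := by
    intro m
    rw [← emitted_take b p le_rfl]
    rfl
  -- If digit `n` were never written, the counter would remain `n`, and `b n` would be consulted on
  -- all longer prefixes.
  have key : ∀ n i, Nat.count P i = n → ∃ i', Nat.count P i' = n ∧ P i' := by
    intro n i hi
    by_contra! hcon
    have hconst : ∀ k, Nat.count P (i + k) = n := by
      intro k
      induction k with
      | zero => exact hi
      | succ k ih => rw [← add_assoc, Nat.count_succ, ih, if_neg (hcon _ ih), add_zero]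
    obtain ⟨J, hJ⟩ := eventually_atTop.1 (h n).2
    refine hcon _ (hconst J) ?_
    have := hd (i + J)
    rw [hconst, hJ (i + J) (by omega)] at this
    change delay b p (i + J) ≠ 0
    simp [this]
  have pos : ∀ n, ∃ i, Nat.count P i = n ∧ P i := by
    intro n
    induction n with
    | zero => exact key 0 0 (Nat.count_zero P)
    | succ n ih =>
      obtain ⟨i, hi, hPi⟩ := ih
      exact key (n + 1) (i + 1) (by rw [Nat.count_succ, hi, if_pos hPi])
  refine ⟨?_, ?_⟩
  · refine Set.infinite_of_injective_forall_mem (f := fun n => (pos n).choose) ?_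
      fun n => (pos n).choose_spec.2
    intro n n' hnn
    have h1 := (pos n).choose_spec.1
    have h2 := (pos n').choose_spec.1
    rw [← h1, ← h2]
    exact congrArg (Nat.count P) hnn
  · funext n
    obtain ⟨i, hi, hPi⟩ := pos n
    have hnth : Nat.nth P n = i := by rw [← hi, Nat.nth_count hPi]
    change delay b p (Nat.nth P n) - 1 = q n
    rw [hnth, hd, hi]
    cases hb : b n (take p i) with
    | none => exact absurd (by rw [hd, hi, hb]) hPi
    | some w => exact (h n).1 i w hb

/-- The delayed outputs for all `j` are interleaved into one sequence. `D x` is total even where `R`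
relates `p` to nothing; such components simply carry no guarantee. -/
theorem RelComputable.exists_totalization {α : Type} [Primcodable α]
    {R : α × ℕ → Baire → Baire → Prop} (hR : RelComputable R) :
    ∃ D : α → Baire → Baire, RelComputable (fun x p q => q = D x p) ∧
      ∀ x j p q, R (x, j) p q → q ∈ Baire.minusOne (proj j (D x p)) := by
  obtain ⟨a, ha, haR⟩ := hR
  refine ⟨fun x p m => delay (fun n l => a ((x, m.unpair.1), n) l) p m.unpair.2, ?_, ?_⟩
  · have hb : Primrec fun z : (((α × ℕ) × List ℕ) × ℕ) × List ℕ =>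
        a ((z.1.1.1.1, z.1.1.1.2.unpair.1), z.1.2) z.2 := by
      have h1 : Primrec fun z : (((α × ℕ) × List ℕ) × ℕ) × List ℕ => z.1.1.1 :=
        Primrec.fst.comp (Primrec.fst.comp .fst)
      exact ha.comp (Primrec.pair (Primrec.pair (Primrec.fst.comp h1)
        (Primrec.fst.comp (Primrec.unpair.comp (Primrec.snd.comp h1))))
        (Primrec.snd.comp .fst)) .snd
    have he : Primrec fun z : (α × ℕ) × List ℕ =>
        emitted (fun n l => a ((z.1.1, z.1.2.unpair.1), n) l) z.2 z.1.2.unpair.2 := by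
      refine Primrec.nat_rec' (h := fun (z : (α × ℕ) × List ℕ) (y : ℕ × ℕ) => y.2 +
        if (a ((z.1.1, z.1.2.unpair.1), y.2) (z.2.take y.1)).isSome then 1 else 0)
        (Primrec.snd.comp (Primrec.unpair.comp (Primrec.snd.comp .fst))) (Primrec.const 0) ?_
      refine Primrec.nat_add.comp (Primrec.snd.comp .snd) (Primrec.ite
        (Primrec.eq.comp (Primrec.option_isSome.comp (hb.comp (Primrec.pair (Primrec.pair .fst
          (Primrec.snd.comp .snd)) (Primrec.list_take.comp (Primrec.fst.comp .snd)
            (Primrec.snd.comp .fst))))) (Primrec.const true))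
        (Primrec.const 1) (Primrec.const 0))
    have hg : Primrec₂ fun (x : α × ℕ) (l : List ℕ) => Option.casesOn (motive := fun _ => ℕ)
        (a ((x.1, x.2.unpair.1), emitted (fun n l => a ((x.1, x.2.unpair.1), n) l) l
          x.2.unpair.2) l) 0 Nat.succ :=
      Primrec.option_casesOn (hb.comp (Primrec.pair (Primrec.pair .id he) .snd))
        (Primrec.const 0) (Primrec.succ.comp .snd)
    refine (ValueComputable.prefix_map hg (e := fun x => x.2.unpair.2)
      (Primrec.snd.comp (Primrec.unpair.comp .snd))).mono ?_
    rintro ⟨x, m⟩ p _ ⟨q, rfl, rfl⟩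
    rfl
  · intro x j p q hq
    have : proj j (fun m => delay (fun n l => a ((x, m.unpair.1), n) l) p m.unpair.2) =
        delay (fun n l => a ((x, j), n) l) p := by
      funext k
      simp [proj]
    rw [this]
    exact mem_minusOne_delay fun n => haR ((x, j), n) p (q n) ⟨q, hq, rfl⟩

end Baire

/-! ### Computable functions and reductions between multi-valued maps on Baire space -/

namespace Baire

variable {α β : Type} [Primcodable α] [Primcodable β]

/-- The sequence `⟨p_{⟨i,0⟩}, p_{⟨i,1⟩}, …⟩` for `p = ⟨p₀, p₁, …⟩`. -/
def block (i : ℕ) (p : Baire) : Baire := fun m => p (Nat.pair (Nat.pair i m.unpair.1) m.unpair.2)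

@[simp] theorem proj_block (i j : ℕ) (p : Baire) : proj j (block i p) = proj (Nat.pair i j) p := by
  funext k; simp [proj, block]

@[simp] theorem tail_cons (n : ℕ) (p : Baire) : tail (cons n p) = p := rfl

@[simp] theorem cons_zero (n : ℕ) (p : Baire) : cons n p 0 = n := rfl

attribute [simp] fst_pair snd_pair

theorem snd_zero (p : Baire) : snd p 0 = p 1 := rfl

theorem snd_one (p : Baire) : snd p 1 = p 3 := rfl

/-- The total function `f x` is computable, uniformly in `x`. -/
def FunComputable (f : α → Baire → Baire) : Prop := RelComputable fun x p q => q = f x p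

theorem RelComputable.subst {R : α → Baire → Baire → Prop} (hR : RelComputable R)
    {f : α → Baire → Baire} (hf : FunComputable f) : RelComputable fun x p => R x (f x p) :=
  (RelComputable.comp hf hR).mono fun _ _ _ h => ⟨_, rfl, h⟩

/-! ### Computable total functions -/

namespace FunComputable

theorem id : FunComputable fun (_ : α) p => p := RelComputable.id

variable {f g : α → Baire → Baire}

theorem comp_param (hf : FunComputable f) {e : β → α} (he : Primrec e) :
    FunComputable fun x => f (e x) := RelComputable.comp_param hf he

theorem comp (hg : FunComputable g) (hf : FunComputable f) :
    FunComputable fun x p => g x (f x p) := RelComputable.subst hg hf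

theorem fst (hf : FunComputable f) : FunComputable fun x p => (f x p).fst :=
  comp (g := fun _ => Baire.fst) (RelComputable.reindex (e := fun _ n => 2 * n)
    (Primrec.nat_mul.comp (Primrec.const 2) .snd)) hf

theorem snd (hf : FunComputable f) : FunComputable fun x p => (f x p).snd :=
  comp (g := fun _ => Baire.snd) (RelComputable.reindex (e := fun _ n => 2 * n + 1)
    (Primrec.succ.comp (Primrec.nat_mul.comp (Primrec.const 2) .snd))) hf

theorem tail (hf : FunComputable f) : FunComputable fun x p => (f x p).tail :=
  comp (g := fun _ => Baire.tail) (RelComputable.reindex (e := fun _ n => n + 1)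
    (Primrec.succ.comp .snd)) hf

theorem proj {e : α → ℕ} (he : Primrec e) (hf : FunComputable f) :
    FunComputable fun x p => Baire.proj (e x) (f x p) :=
  comp (g := fun x => Baire.proj (e x)) (RelComputable.reindex (e := fun x n => Nat.pair (e x) n)
    (Primrec₂.natPair.comp (he.comp .fst) .snd)) hf

theorem block {e : α → ℕ} (he : Primrec e) (hf : FunComputable f) :
    FunComputable fun x p => Baire.block (e x) (f x p) :=
  comp (g := fun x => Baire.block (e x)) (RelComputable.reindex
    (e := fun x m => Nat.pair (Nat.pair (e x) m.unpair.1) m.unpair.2)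
    (Primrec₂.natPair.comp (Primrec₂.natPair.comp (he.comp .fst)
      (Primrec.fst.comp (Primrec.unpair.comp .snd))) (Primrec.snd.comp (Primrec.unpair.comp .snd))))
    hf

theorem cons {c : α → ℕ} (hc : Primrec c) (hf : FunComputable f) :
    FunComputable fun x p => Baire.cons (c x) (f x p) :=
  comp (g := fun x => Baire.cons (c x)) (RelComputable.cons hc) hf

theorem pair (hf : FunComputable f) (hg : FunComputable g) :
    FunComputable fun x p => Baire.pair (f x p) (g x p) :=
  (RelComputable.pair hf hg).mono fun _ _ _ h => ⟨_, _, rfl, rfl, h⟩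

theorem minusOne (hf : FunComputable f) : RelComputable fun x p q => q ∈ Baire.minusOne (f x p) :=
  RelComputable.subst RelComputable.minusOne hf

end FunComputable

theorem RelComputable.map {R : α → Baire → Baire → Prop} (hR : RelComputable R)
    {f : α → Baire → Baire} (hf : FunComputable f) :
    RelComputable fun x p r => ∃ q, R x p q ∧ r = f x q :=
  hR.comp hf

/-- The totalization of a multi-valued map on Baire space, with respect to `p ↦ p - 1`, applied to
all components of a sequence of sequences. -/
def totalPower (R : Baire → Set Baire) (p : Baire) : Set Baire :=
  {r | ∀ n, ∀ u ∈ minusOne (proj n p), (R u).Nonempty → ∃ v ∈ minusOne (proj n r), v ∈ R u}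

/-- The coproduct of multi-valued maps on Baire space. -/
def sumMap (R S : Baire → Set Baire) (p : Baire) : Set Baire :=
  {r | (p 0 = 0 ∧ r 0 = 0 ∧ tail r ∈ R (tail p)) ∨ (p 0 = 1 ∧ r 0 = 1 ∧ tail r ∈ S (tail p))}

/-- The meet of multi-valued maps on Baire space. -/
def meetMap (R S : Baire → Set Baire) (p : Baire) : Set Baire :=
  {r | (R (fst p)).Nonempty ∧ (S (snd p)).Nonempty ∧
    ((r 0 = 0 ∧ tail r ∈ R (fst p)) ∨ (r 0 = 1 ∧ tail r ∈ S (snd p)))}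

/-- The multiplicative implication of multi-valued maps on Baire space. -/
def impMap (S R : Baire → Set Baire) (p : Baire) : Set Baire :=
  {z | ∃ (n k : ℕ) (q : Baire), z = cons n (cons k q) ∧
    ∃ s ∈ phi k p, (S s).Nonempty ∧ ∀ t ∈ S s, ∃ w ∈ phi n (pair q t), w ∈ R p}

/-- Weihrauch reducibility of multi-valued maps on Baire space. -/
def Reduces (R S : Baire → Set Baire) : Prop :=
  ∃ H K : Baire → Baire → Prop,
    RelComputable (fun _ : Unit => H) ∧ RelComputable (fun _ : Unit => K) ∧
    ∀ p, (R p).Nonempty → ∃ s, K p s ∧ (S s).Nonempty ∧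
      ∀ r ∈ S s, ∃ w, H (pair p r) w ∧ w ∈ R p

/-- Each component decodes to at most one `u`, so at most one value is owed there; values are chosen
without regard to computability. -/
theorem totalPower_nonempty (R : Baire → Set Baire) (p : Baire) : (totalPower R p).Nonempty := by
  have h : ∀ n, ∃ r : Baire, ∀ u ∈ minusOne (proj n p), (R u).Nonempty →
      ∃ v ∈ minusOne r, v ∈ R u := by
    intro n
    by_cases hu : ∃ u ∈ minusOne (proj n p), (R u).Nonempty
    · obtain ⟨u, hu, v, hv⟩ := hu
      refine ⟨fun i => v i + 1, fun u' hu' _ => ⟨v, minusOne_succ v, ?_⟩⟩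
      rwa [Part.mem_unique hu' hu]
    · exact ⟨p, fun u hu' hR => absurd ⟨u, hu', hR⟩ hu⟩
  choose r hr using h
  refine ⟨fun m => r m.unpair.1 m.unpair.2, fun n => ?_⟩
  have : proj n (fun m => r m.unpair.1 m.unpair.2) = r n := by
    funext k; simp [proj]
  rw [this]
  exact hr n

theorem mem_sumMap_cons_zero {R S : Baire → Set Baire} {u r : Baire} :
    r ∈ sumMap R S (cons 0 u) ↔ r 0 = 0 ∧ tail r ∈ R u := by
  simp [sumMap]

theorem mem_sumMap_cons_one {R S : Baire → Set Baire} {u r : Baire} :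
    r ∈ sumMap R S (cons 1 u) ↔ r 0 = 1 ∧ tail r ∈ S u := by
  simp [sumMap]

/-! ### Reductions between multi-valued maps -/

namespace Reduces

variable {R S T : Baire → Set Baire}

theorem intro {H K : Unit → Baire → Baire → Prop} (hH : RelComputable H) (hK : RelComputable K)
    (h : ∀ p, (R p).Nonempty → ∃ s, K () p s ∧ (S s).Nonempty ∧
      ∀ r ∈ S s, ∃ w, H () (pair p r) w ∧ w ∈ R p) : Reduces R S :=
  ⟨H (), K (), hH, hK, h⟩

theorem of_total {f g : Unit → Baire → Baire} (hf : FunComputable f) (hg : FunComputable g)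
    (h : ∀ p, (R p).Nonempty → (S (g () p)).Nonempty ∧
      ∀ r ∈ S (g () p), f () (pair p r) ∈ R p) : Reduces R S :=
  intro hf hg fun p hp => ⟨_, rfl, (h p hp).1, fun r hr => ⟨_, rfl, (h p hp).2 r hr⟩⟩

theorem trans (h₁ : Reduces R S) (h₂ : Reduces S T) : Reduces R T := by
  obtain ⟨H₁, K₁, hH₁, hK₁, h₁⟩ := h₁
  obtain ⟨H₂, K₂, hH₂, hK₂, h₂⟩ := h₂
  refine ⟨_, _, (hK₁.subst (FunComputable.id.fst)).comp_pair ((hH₂.subst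
    (FunComputable.id.snd.pair FunComputable.id.fst.snd)).comp_pair
    (hH₁.subst (FunComputable.id.fst.fst.fst.pair FunComputable.id.snd))),
    hK₁.comp hK₂, fun p hp => ?_⟩
  obtain ⟨s, hs, hne, hs'⟩ := h₁ p hp
  obtain ⟨t, ht, hne', ht'⟩ := h₂ s hne
  refine ⟨t, ⟨s, hs, ht⟩, hne', fun r hr => ?_⟩
  obtain ⟨v, hv, hvS⟩ := ht' r hr
  obtain ⟨w, hw, hwR⟩ := hs' v hvS
  exact ⟨w, ⟨s, by simpa using hs, v, by simpa using hv, by simpa using hw⟩, hwR⟩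

theorem totalPower_self (R : Baire → Set Baire) : Reduces R (totalPower R) := by
  -- Every component of `D p` is a delayed name of `p`; component `0` of the answer is read.
  obtain ⟨D, hD, hD'⟩ := (RelComputable.id (α := Unit × ℕ)).exists_totalization
  refine intro (FunComputable.id.snd.proj (Primrec.const 0)).minusOne hD fun p hp =>
    ⟨_, rfl, totalPower_nonempty _ _, fun r hr => ?_⟩
  obtain ⟨v, hv, hvR⟩ := hr 0 p (hD' () 0 p p rfl) hp
  exact ⟨v, by simpa using hv, hvR⟩

/-- Countably many instances, each asking countably many questions, make up one countable family:
question `j` of instance `i` goes into component `⟨i, j⟩`, and `block i` recovers the answers for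
instance `i`. Invalid instances need no answer, so their divergence is harmless after totalization.
-/
theorem totalPower_of (h : Reduces S (totalPower T)) :
    Reduces (totalPower S) (totalPower T) := by
  obtain ⟨H, K, hH, hK, h⟩ := h
  have e₁ : Primrec fun x : Unit × ℕ => x.2.unpair.1 :=
    Primrec.fst.comp (Primrec.unpair.comp .snd)
  have e₂ : Primrec fun x : Unit × ℕ => x.2.unpair.2 :=
    Primrec.snd.comp (Primrec.unpair.comp .snd)
  obtain ⟨D, hD, hD'⟩ := ((FunComputable.id.proj e₁).minusOne.comp
    ((hK.comp_param Primrec.fst).comp (FunComputable.id.proj e₂).minusOne)).exists_totalization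
  obtain ⟨E, hE, hE'⟩ := ((FunComputable.id.fst.proj Primrec.snd).minusOne.comp_pair
    ((hH.comp_param Primrec.fst).subst (FunComputable.id.snd.pair
      (FunComputable.id.fst.snd.block Primrec.snd)))).exists_totalization (α := Unit)
  refine intro hE hD fun p _ => ⟨_, rfl, totalPower_nonempty _ _, fun r hr =>
    ⟨_, rfl, fun i u hu hne => ?_⟩⟩
  obtain ⟨s, hs, -, hs'⟩ := h u hne
  obtain ⟨w, hw, hwS⟩ := hs' (block i r) fun j v hv hvne => by
    rw [proj_block]
    exact hr (Nat.pair i j) v (hD' () _ p v ⟨u, by simpa using hu, s, hs, by simpa using hv⟩) hvne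
  exact ⟨w, hE' () i _ w ⟨u, by simpa using hu, by simpa using hw⟩, hwS⟩

theorem identity_totalPower : Reduces (fun p => {p}) (totalPower R) :=
  of_total FunComputable.id.fst FunComputable.id
    fun p _ => ⟨totalPower_nonempty _ _, fun r _ => fst_pair p r⟩

theorem left_sumMap : Reduces R (sumMap R S) :=
  of_total FunComputable.id.snd.tail (FunComputable.id.cons (Primrec.const 0)) fun p ⟨w, hw⟩ =>
    ⟨⟨cons 0 w, mem_sumMap_cons_zero.2 ⟨rfl, hw⟩⟩, fun r hr => by
      simpa using (mem_sumMap_cons_zero.1 hr).2⟩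

theorem right_sumMap : Reduces S (sumMap R S) :=
  of_total FunComputable.id.snd.tail (FunComputable.id.cons (Primrec.const 1)) fun p ⟨w, hw⟩ =>
    ⟨⟨cons 1 w, mem_sumMap_cons_one.2 ⟨rfl, hw⟩⟩, fun r hr => by
      simpa using (mem_sumMap_cons_one.1 hr).2⟩

theorem primrecPred_eq_zero : PrimrecPred fun x : Unit × ℕ => x.2 = 0 :=
  Primrec.eq.comp .snd (Primrec.const 0)

theorem sumMap_of (h₁ : Reduces R T) (h₂ : Reduces S T) : Reduces (sumMap R S) T := by
  obtain ⟨H₁, K₁, hH₁, hK₁, h₁⟩ := h₁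
  obtain ⟨H₂, K₂, hH₂, hK₂, h₂⟩ := h₂
  have hK := (RelComputable.ite primrecPred_eq_zero
    ((hK₁.comp_param Primrec.fst).subst FunComputable.id.tail)
    ((hK₂.comp_param Primrec.fst).subst FunComputable.id.tail)).branch (Primrec.const 0)
  have hH := (RelComputable.ite primrecPred_eq_zero
    (((hH₁.comp_param Primrec.fst).subst
      (FunComputable.id.fst.tail.pair FunComputable.id.snd)).map
      (FunComputable.id.cons (Primrec.const 0)))
    (((hH₂.comp_param Primrec.fst).subst
      (FunComputable.id.fst.tail.pair FunComputable.id.snd)).map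
      (FunComputable.id.cons (Primrec.const 1)))).branch (Primrec.const 0)
  refine intro hH hK ?_
  have hz : ∀ p r, pair p r 0 = p 0 := fun _ _ => rfl
  rintro p ⟨w, ⟨hp, -, hw⟩ | ⟨hp, -, hw⟩⟩
  · obtain ⟨s, hs, hne, hs'⟩ := h₁ _ ⟨_, hw⟩
    refine ⟨s, by simpa [hp] using hs, hne, fun r hr => ?_⟩
    obtain ⟨v, hv, hvR⟩ := hs' r hr
    exact ⟨cons 0 v, by simpa [hz, hp] using ⟨v, hv, rfl⟩, Or.inl ⟨hp, rfl, hvR⟩⟩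
  · obtain ⟨s, hs, hne, hs'⟩ := h₂ _ ⟨_, hw⟩
    refine ⟨s, by simpa [hp] using hs, hne, fun r hr => ?_⟩
    obtain ⟨v, hv, hvR⟩ := hs' r hr
    exact ⟨cons 1 v, by simpa [hz, hp] using ⟨v, hv, rfl⟩, Or.inr ⟨hp, rfl, hvR⟩⟩

theorem meetMap_left : Reduces (meetMap R S) R :=
  of_total (FunComputable.id.snd.cons (Primrec.const 0)) FunComputable.id.fst
    fun p ⟨_, h₁, h₂, _⟩ => ⟨h₁, fun r hr => ⟨h₁, h₂, Or.inl ⟨rfl, by simpa using hr⟩⟩⟩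

theorem meetMap_right : Reduces (meetMap R S) S :=
  of_total (FunComputable.id.snd.cons (Primrec.const 1)) FunComputable.id.snd
    fun p ⟨_, h₁, h₂, _⟩ => ⟨h₂, fun r hr => ⟨h₁, h₂, Or.inr ⟨rfl, by simpa using hr⟩⟩⟩

theorem meetMap_of (h₁ : Reduces T R) (h₂ : Reduces T S) : Reduces T (meetMap R S) := by
  obtain ⟨H₁, K₁, hH₁, hK₁, h₁⟩ := h₁
  obtain ⟨H₂, K₂, hH₂, hK₂, h₂⟩ := h₂
  have hH := (RelComputable.ite primrecPred_eq_zero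
    ((hH₁.comp_param Primrec.fst).subst (FunComputable.id.fst.pair FunComputable.id.snd.tail))
    ((hH₂.comp_param Primrec.fst).subst
      (FunComputable.id.fst.pair FunComputable.id.snd.tail))).branch (Primrec.const 1)
  refine intro hH (hK₁.pair hK₂) fun p hp => ?_
  obtain ⟨s, hs, ⟨r₀, hr₀⟩, hs'⟩ := h₁ p hp
  obtain ⟨t, ht, hnet, ht'⟩ := h₂ p hp
  refine ⟨pair s t, ⟨s, t, hs, ht, rfl⟩, ⟨cons 0 r₀, ?_⟩, ?_⟩
  · simp only [meetMap, fst_pair, snd_pair]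
    exact ⟨⟨_, hr₀⟩, hnet, Or.inl ⟨rfl, hr₀⟩⟩
  · rintro r ⟨-, -, ⟨hr0, hr⟩ | ⟨hr0, hr⟩⟩
    · obtain ⟨w, hw, hwT⟩ := hs' (tail r) (by simpa using hr)
      have : pair p r 1 = 0 := hr0
      exact ⟨w, by simpa [this] using hw, hwT⟩
    · obtain ⟨w, hw, hwT⟩ := ht' (tail r) (by simpa using hr)
      have : pair p r 1 = 1 := hr0
      exact ⟨w, by simpa [this] using hw, hwT⟩

/-- The index `k` is known only after `T` has answered, yet `S` must be asked in parallel, so `S` is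
asked about `φ_k(p)` for every `k`. -/
theorem sumMap_of_impMap (hR : ∀ p, (R p).Nonempty)
    (h : Reduces (impMap (totalPower S) R) (totalPower T)) :
    Reduces R (totalPower (sumMap S T)) := by
  obtain ⟨H, K, hH, hK, h⟩ := h
  have e₁ : Primrec fun x : Unit × ℕ => x.2.unpair.1 :=
    Primrec.fst.comp (Primrec.unpair.comp .snd)
  have e₂ : Primrec fun x : Unit × ℕ => x.2.unpair.2 :=
    Primrec.snd.comp (Primrec.unpair.comp .snd)
  -- Block `0` holds the questions to `T` with tag `1`; block `k + 1` holds the components of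
  -- `φ_k(p)` as questions to `S` with tag `0`.
  obtain ⟨D, hD, hD'⟩ := (RelComputable.ite (P := fun x : Unit × ℕ => x.2.unpair.1 = 0)
    (Primrec.eq.comp e₁ (Primrec.const 0))
    ((hK.comp_param Primrec.fst).comp ((FunComputable.id.proj e₂).minusOne.map
      (FunComputable.id.cons (Primrec.const 1))))
    ((RelComputable.phi.comp_param (Primrec.pred.comp e₁)).comp
      ((FunComputable.id.proj e₂).minusOne.map
        (FunComputable.id.cons (Primrec.const 0))))).exists_totalization
  -- `E` strips the tags from the answers.
  obtain ⟨E, hE, hE'⟩ := ((FunComputable.id.proj Primrec.snd).minusOne.map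
    FunComputable.id.tail).exists_totalization (α := Unit)
  have hE₂ : FunComputable fun (_ : (Unit × ℕ) × ℕ) => E () := hE.comp_param (Primrec.const ())
  -- Paired with the original input, `z = ⟨n, k, q⟩` occupies the odd places: `n` is digit `1` and
  -- `k` is digit `3`.
  have hout := ((RelComputable.phi.comp_param (Primrec.snd.comp Primrec.fst)).subst
    (FunComputable.id.snd.tail.tail.pair ((hE₂.comp FunComputable.id.fst.snd).block
      (Primrec.succ.comp Primrec.snd)))).branch (Primrec.const 3) |>.branch (Primrec.const 1)
  have hHE := hH.subst (FunComputable.id.fst.pair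
    ((FunComputable.comp hE FunComputable.id.snd).block (Primrec.const 0)))
  refine intro (hHE.comp_pair hout) hD fun p _ => ⟨_, rfl, totalPower_nonempty _ _, ?_⟩
  intro r hr
  -- A value `w ∈ R p` may itself be stored as `q`, with `φ_n` the first projection. This is where
  -- totality of `R` enters.
  have hne : (impMap (totalPower S) R p).Nonempty := by
    obtain ⟨w, hw⟩ := hR p
    obtain ⟨n, hn⟩ := RelComputable.exists_phi (FunComputable.id.fst (α := Unit)) ()
    obtain ⟨k, hk⟩ := RelComputable.exists_phi (FunComputable.id (α := Unit)) ()
    exact ⟨_, n, k, w, rfl, p, hk p p rfl, totalPower_nonempty _ _, fun t _ =>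
      ⟨w, hn _ _ (fst_pair w t).symm, hw⟩⟩
  obtain ⟨s, hs, -, hs'⟩ := h p hne
  obtain ⟨_, hz, n, k, q, rfl, s₁, hs₁, -, hs₁'⟩ := hs' (block 0 (E () r)) fun j v hv ⟨y, hy⟩ => by
    obtain ⟨u, hu, hu'⟩ := hr (Nat.pair 0 j) (cons 1 v)
      (hD' () _ p _ (by simpa using ⟨s, hs, v, hv, rfl⟩))
      ⟨cons 1 y, mem_sumMap_cons_one.2 ⟨rfl, hy⟩⟩
    exact ⟨tail u, by rw [proj_block]; exact hE' () (Nat.pair 0 j) r _ ⟨u, hu, rfl⟩,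
      (mem_sumMap_cons_one.1 hu').2⟩
  obtain ⟨w, hw, hwR⟩ := hs₁' (block (k + 1) (E () r)) fun j v hv ⟨y, hy⟩ => by
    obtain ⟨u, hu, hu'⟩ := hr (Nat.pair (k + 1) j) (cons 0 v)
      (hD' () _ p _ (by simpa using ⟨s₁, hs₁, v, hv, rfl⟩))
      ⟨cons 0 y, mem_sumMap_cons_zero.2 ⟨rfl, hy⟩⟩
    exact ⟨tail u, by rw [proj_block]; exact hE' () (Nat.pair (k + 1) j) r _ ⟨u, hu, rfl⟩,
      (mem_sumMap_cons_zero.1 hu').2⟩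
  refine ⟨w, ⟨_, by simpa using hz, ?_⟩, hwR⟩
  simp only [← snd_zero, ← snd_one, snd_pair, fst_pair]
  exact hw

/-- One untagged sequence `D p` serves as the question to `S` and to `T` alike. The superfluous
answers are discarded once the tags, recomputed from `p`, show which oracle each component was meant
for. -/
theorem impMap_of_sumMap (h : Reduces R (totalPower (sumMap S T))) :
    Reduces (impMap (totalPower S) R) (totalPower T) := by
  obtain ⟨H, K, hH, hK, h⟩ := h
  obtain ⟨D, hD, hD'⟩ := ((hK.comp_param Primrec.fst).comp
    ((FunComputable.id.proj Primrec.snd).minusOne.map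
      FunComputable.id.tail)).exists_totalization (α := Unit)
  have e : Primrec fun x : (Unit × ℕ) × ℕ => x.1.2 := Primrec.snd.comp .fst
  -- The input is `⟨⟨⟨s, r⟩, t⟩, v⟩`, so digit `1` is the tag of `v`: tag `0` selects the answers
  -- `t` of `S`, otherwise those `r` of `T`.
  have hcase := (RelComputable.ite (P := fun x : (Unit × ℕ) × ℕ => x.2 = 0)
    (Primrec.eq.comp .snd (Primrec.const 0))
    ((FunComputable.id.fst.snd.proj e).minusOne.map (FunComputable.id.cons (Primrec.const 0)))
    ((FunComputable.id.fst.fst.snd.proj e).minusOne.map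
      (FunComputable.id.cons (Primrec.const 1)))).branch (Primrec.const 1)
  obtain ⟨E, hE, hE'⟩ := ((FunComputable.id.fst.fst.proj Primrec.snd).minusOne.comp_pair
    hcase).exists_totalization (α := Unit)
  obtain ⟨k, hk⟩ := hD.exists_phi ()
  obtain ⟨n, hn⟩ := ((hK.subst FunComputable.id.fst.fst).comp_pair (hH.subst
    (FunComputable.id.fst.fst.fst.pair (FunComputable.comp hE ((FunComputable.id.snd.pair
      FunComputable.id.fst.fst.snd).pair FunComputable.id.fst.snd))))).exists_phi ()
  refine intro ((FunComputable.id.cons (Primrec.const k)).cons (Primrec.const n)) hD ?_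
  rintro p ⟨_, _, _, _, _, _, _, ⟨t₀, ht₀⟩, himp⟩
  obtain ⟨w₀, -, hw₀⟩ := himp t₀ ht₀
  obtain ⟨s, hs, -, hs'⟩ := h p ⟨w₀, hw₀⟩
  -- The stored `q = ⟨p, r⟩` keeps the input and the answers of `T` available to `φ_n`.
  refine ⟨_, rfl, totalPower_nonempty _ _, fun r hr => ⟨_, rfl, n, k, pair p r, rfl, D () p,
    hk _ _ rfl, totalPower_nonempty _ _, fun t ht => ?_⟩⟩
  obtain ⟨w, hw, hwR⟩ := hs' (E () (pair (pair s r) t)) fun j v hv hne => by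
    have hDv := hD' () j p (tail v) ⟨s, hs, v, hv, rfl⟩
    have hv1 : ∀ z, pair z v 1 = v 0 := fun _ => rfl
    obtain ⟨y, ⟨hv0, -, hy⟩ | ⟨hv0, -, hy⟩⟩ := hne
    · obtain ⟨u, hu, hu'⟩ := ht j _ hDv ⟨_, hy⟩
      exact ⟨cons 0 u, hE' () j _ _ ⟨v, by simpa using hv, by simpa [hv1, hv0] using ⟨u, hu, rfl⟩⟩,
        Or.inl ⟨hv0, rfl, hu'⟩⟩
    · obtain ⟨u, hu, hu'⟩ := hr j _ hDv ⟨_, hy⟩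
      exact ⟨cons 1 u, hE' () j _ _ ⟨v, by simpa using hv, by simpa [hv1, hv0] using ⟨u, hu, rfl⟩⟩,
        Or.inr ⟨hv0, rfl, hu'⟩⟩
  exact ⟨w, hn _ _ ⟨s, by simpa using hs, by simpa using hw⟩, hwR⟩

end Reduces

end Baire

/-! ### Realizer versions of the operations on problems -/

namespace RepSpace

theorem mem_seq_rep {X : RepSpace} {p : Baire} {x : ℕ → X.carrier} :
    x ∈ X.seq.rep p ↔ ∀ n, x n ∈ X.rep (Baire.proj n p) := by
  constructor
  · rintro ⟨h, rfl⟩ n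
    exact Part.get_mem (h n)
  · intro h
    exact ⟨fun n => (h n).1, funext fun n => (h n).2⟩

theorem eq_some_iff_of_mem_completion_rep {X : RepSpace} {p : Baire} {x : Option X.carrier}
    (hx : x ∈ X.completion.rep p) {x' : X.carrier} :
    x = some x' ↔ ∃ u ∈ Baire.minusOne p, x' ∈ X.rep u := by
  classical
  rw [Part.mem_some_iff.1 hx, Part.toOption_eq_some_iff]
  exact Part.mem_bind_iff

theorem exists_mem_completion_rep (X : RepSpace) (p : Baire) : ∃ x, x ∈ X.completion.rep p :=
  ⟨_, Part.mem_some _⟩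

theorem mem_prod_rep {X Y : RepSpace} {p : Baire} {x : X.carrier × Y.carrier} :
    x ∈ (X.prod Y).rep p ↔ x.1 ∈ X.rep p.fst ∧ x.2 ∈ Y.rep p.snd := by
  constructor
  · intro h
    obtain ⟨a, ha, h⟩ := Part.mem_bind_iff.1 h
    obtain ⟨b, hb, rfl⟩ := (Part.mem_map_iff _).1 h
    exact ⟨ha, hb⟩
  · exact fun ⟨ha, hb⟩ => Part.mem_bind ha (Part.mem_map (Prod.mk x.1) hb)

theorem inl_mem_sum_rep {X Y : RepSpace} {p : Baire} {x : X.carrier} :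
    (Sum.inl x : X.carrier ⊕ Y.carrier) ∈ (X.sum Y).rep p ↔ p 0 = 0 ∧ x ∈ X.rep p.tail := by
  constructor
  · intro h
    dsimp only [sum] at h
    split at h
    · obtain ⟨a, ha, hax⟩ := (Part.mem_map_iff _).1 h
      exact ⟨‹_›, Sum.inl_injective hax ▸ ha⟩
    · obtain ⟨a, -, hax⟩ := (Part.mem_map_iff _).1 h
      cases hax
    · exact (Part.notMem_none _ h).elim
  · rintro ⟨h0, h⟩
    dsimp only [sum]
    rw [h0]
    exact Part.mem_map Sum.inl h

theorem inr_mem_sum_rep {X Y : RepSpace} {p : Baire} {y : Y.carrier} :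
    (Sum.inr y : X.carrier ⊕ Y.carrier) ∈ (X.sum Y).rep p ↔ p 0 = 1 ∧ y ∈ Y.rep p.tail := by
  constructor
  · intro h
    dsimp only [sum] at h
    split at h
    · obtain ⟨a, -, hax⟩ := (Part.mem_map_iff _).1 h
      cases hax
    · obtain ⟨a, ha, hax⟩ := (Part.mem_map_iff _).1 h
      exact ⟨‹_›, Sum.inr_injective hax ▸ ha⟩
    · exact (Part.notMem_none _ h).elim
  · rintro ⟨h0, h⟩
    dsimp only [sum]
    rw [h0]
    exact Part.mem_map Sum.inr h

end RepSpace

/-! ### From problems to maps on Baire space -/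

namespace Problem

open Baire

theorem realizerVersion_nonempty {f : Problem} {p : Baire} :
    (f.realizerVersion p).Nonempty ↔ ∃ x ∈ f.source.rep p, x ∈ f.dom := by
  constructor
  · rintro ⟨r, x, hx, y, -, hy⟩
    exact ⟨x, hx, y, hy⟩
  · rintro ⟨x, hx, y, hy⟩
    obtain ⟨r, hr⟩ := f.target.rep_surj y
    exact ⟨r, x, hx, y, hr, hy⟩

theorem mem_realizerVersion_iff {f : Problem} {p r : Baire} {x : f.source.carrier}
    (hx : x ∈ f.source.rep p) :
    r ∈ f.realizerVersion p ↔ ∃ y ∈ f.target.rep r, y ∈ f.val x := by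
  constructor
  · rintro ⟨x', hx', h⟩
    rwa [Part.mem_unique hx hx']
  · exact fun h => ⟨x, hx, h⟩

theorem realizes_iff {F : Baire →. Baire} {f : Problem} :
    Realizes F f ↔ ∀ p, (f.realizerVersion p).Nonempty → ∃ q ∈ F p, q ∈ f.realizerVersion p := by
  constructor
  · intro h p hp
    obtain ⟨x, hx, hxd⟩ := realizerVersion_nonempty.1 hp
    obtain ⟨q, hq, hy⟩ := h p x hx hxd
    exact ⟨q, hq, (mem_realizerVersion_iff hx).2 hy⟩
  · intro h p x hx hxd
    obtain ⟨q, hq, hr⟩ := h p (realizerVersion_nonempty.2 ⟨x, hx, hxd⟩)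
    exact ⟨q, hq, (mem_realizerVersion_iff hx).1 hr⟩

/-- Realizers choose their answers arbitrarily, so success with every realizer amounts to success
with every single answer. -/
theorem leW_iff {f g : Problem} :
    f.LeW g ↔ Reduces f.realizerVersion g.realizerVersion := by
  classical
  constructor
  · rintro ⟨H, K, ⟨n, hn⟩, ⟨k, hk⟩, h⟩
    refine ⟨fun p q => q ∈ phi n p, fun p q => q ∈ phi k p,
      RelComputable.phi.comp_param (Primrec.const n),
      RelComputable.phi.comp_param (Primrec.const k), fun p hp => ?_⟩
    let D : Set Baire := {s | (g.realizerVersion s).Nonempty}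
    have hG : ∀ c : ∀ s ∈ D, g.realizerVersion s, ∃ s ∈ K p, ∃ hs : s ∈ D,
        ∃ w ∈ H (pair p (c s hs)), w ∈ f.realizerVersion p := by
      intro c
      obtain ⟨w, hw, hwf⟩ := realizes_iff.1 (h (fun s => ⟨s ∈ D, fun hs => c s hs⟩)
        (realizes_iff.2 fun s hs => ⟨_, ⟨hs, rfl⟩, (c s hs).2⟩)) p hp
      obtain ⟨r, hr, hw⟩ := Part.mem_bind_iff.1 hw
      obtain ⟨s, hs, hs', rfl⟩ := Part.mem_bind_iff.1 hr
      exact ⟨s, hs, hs', w, hw, hwf⟩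
    obtain ⟨s, hs, hsD, -⟩ := hG fun s hs => ⟨hs.some, hs.some_mem⟩
    refine ⟨s, hk _ _ hs, hsD, fun r hr => ?_⟩
    -- The realizer is modified at `s` alone, so that it answers `r` there.
    obtain ⟨s', hs', hsD', w, hw, hwf⟩ := hG fun s' hs' =>
      if e : s' = s then ⟨r, e ▸ hr⟩ else ⟨hs'.some, hs'.some_mem⟩
    obtain rfl := Part.mem_unique hs hs'
    rw [dif_pos rfl] at hw
    exact ⟨w, hn _ _ hw, hwf⟩
  · rintro ⟨H, K, hH, hK, h⟩
    obtain ⟨n, hn⟩ := hH.exists_phi ()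
    obtain ⟨k, hk⟩ := hK.exists_phi ()
    refine ⟨phi n, phi k, ⟨n, fun _ _ => id⟩, ⟨k, fun _ _ => id⟩, fun G hG =>
      realizes_iff.2 fun p hp => ?_⟩
    obtain ⟨s, hs, hne, hs'⟩ := h p hp
    obtain ⟨r, hr, hrg⟩ := realizes_iff.1 hG s hne
    obtain ⟨w, hw, hwf⟩ := hs' r hrg
    exact ⟨w, Part.mem_bind (Part.mem_bind (hk _ _ hs) hr) (hn _ _ hw), hwf⟩

/-- Completed spaces are totally represented, so every sequence is a name. A constraint arises only
where `p_n - 1` names a point of the domain, and there `⊥` is no admissible answer. -/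
theorem realizerVersion_parallelization_completion (f : Problem) :
    f.completion.parallelization.realizerVersion = totalPower f.realizerVersion := by
  funext p
  ext r
  constructor
  · rintro ⟨x, hx, y, hy, hxy⟩ n u hu ⟨w, x', hx', y', -, hy'⟩
    have hxn := RepSpace.mem_seq_rep.1 hx n
    have hyn := RepSpace.mem_seq_rep.1 hy n
    obtain ⟨z, hz, hyz⟩ := hxy n x'
      ((RepSpace.eq_some_iff_of_mem_completion_rep hxn).2 ⟨u, hu, hx'⟩) ⟨y', hy'⟩
    obtain ⟨v, hv, hzv⟩ := (RepSpace.eq_some_iff_of_mem_completion_rep hyn).1 hyz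
    exact ⟨v, hv, x', hx', z, hzv, hz⟩
  · intro h
    choose x hx using fun n => f.source.exists_mem_completion_rep (proj n p)
    choose y hy using fun n => f.target.exists_mem_completion_rep (proj n r)
    refine ⟨x, RepSpace.mem_seq_rep.2 hx, y, RepSpace.mem_seq_rep.2 hy, fun n x' hx' hxd => ?_⟩
    obtain ⟨u, hu, hux⟩ := (RepSpace.eq_some_iff_of_mem_completion_rep (hx n)).1 hx'
    obtain ⟨v, hv, hvr⟩ := h n u hu (realizerVersion_nonempty.2 ⟨x', hux, hxd⟩)
    obtain ⟨z, hz, hzx⟩ := (mem_realizerVersion_iff hux).1 hvr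
    exact ⟨z, hzx, (RepSpace.eq_some_iff_of_mem_completion_rep (hy n)).2 ⟨v, hv, hz⟩⟩

theorem realizerVersion_coprod (f g : Problem) :
    (f.coprod g).realizerVersion = sumMap f.realizerVersion g.realizerVersion := by
  funext p
  ext r
  constructor
  · rintro ⟨x | x, hx, y, hy, z, hz, rfl⟩
    · obtain ⟨hp, hx⟩ := RepSpace.inl_mem_sum_rep.1 hx
      obtain ⟨hr, hy⟩ := RepSpace.inl_mem_sum_rep.1 hy
      exact Or.inl ⟨hp, hr, x, hx, z, hy, hz⟩
    · obtain ⟨hp, hx⟩ := RepSpace.inr_mem_sum_rep.1 hx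
      obtain ⟨hr, hy⟩ := RepSpace.inr_mem_sum_rep.1 hy
      exact Or.inr ⟨hp, hr, x, hx, z, hy, hz⟩
  · rintro (⟨hp, hr, x, hx, y, hy, hxy⟩ | ⟨hp, hr, x, hx, y, hy, hxy⟩)
    · exact ⟨Sum.inl x, RepSpace.inl_mem_sum_rep.2 ⟨hp, hx⟩, Sum.inl y,
        RepSpace.inl_mem_sum_rep.2 ⟨hr, hy⟩, y, hxy, rfl⟩
    · exact ⟨Sum.inr x, RepSpace.inr_mem_sum_rep.2 ⟨hp, hx⟩, Sum.inr y,
        RepSpace.inr_mem_sum_rep.2 ⟨hr, hy⟩, y, hxy, rfl⟩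

theorem realizerVersion_meet (f g : Problem) :
    (f.meet g).realizerVersion = meetMap f.realizerVersion g.realizerVersion := by
  funext p
  ext r
  constructor
  · rintro ⟨x, hx, y, hy, hf, hg, h⟩
    obtain ⟨hx₁, hx₂⟩ := RepSpace.mem_prod_rep.1 hx
    refine ⟨realizerVersion_nonempty.2 ⟨_, hx₁, hf⟩, realizerVersion_nonempty.2 ⟨_, hx₂, hg⟩, ?_⟩
    rcases h with ⟨z, hz, rfl⟩ | ⟨z, hz, rfl⟩
    · obtain ⟨hr, hy⟩ := RepSpace.inl_mem_sum_rep.1 hy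
      exact Or.inl ⟨hr, _, hx₁, z, hy, hz⟩
    · obtain ⟨hr, hy⟩ := RepSpace.inr_mem_sum_rep.1 hy
      exact Or.inr ⟨hr, _, hx₂, z, hy, hz⟩
  · rintro ⟨hf, hg, h⟩
    obtain ⟨x, hx, hxd⟩ := realizerVersion_nonempty.1 hf
    obtain ⟨u, hu, hud⟩ := realizerVersion_nonempty.1 hg
    have hxu : (x, u) ∈ (f.source.prod g.source).rep p := RepSpace.mem_prod_rep.2 ⟨hx, hu⟩
    rcases h with ⟨hr, h⟩ | ⟨hr, h⟩
    · obtain ⟨y, hy, hyx⟩ := (mem_realizerVersion_iff hx).1 h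
      exact ⟨(x, u), hxu, Sum.inl y, RepSpace.inl_mem_sum_rep.2 ⟨hr, hy⟩, hxd, hud,
        Or.inl ⟨y, hyx, rfl⟩⟩
    · obtain ⟨y, hy, hyx⟩ := (mem_realizerVersion_iff hu).1 h
      exact ⟨(x, u), hxu, Sum.inr y, RepSpace.inr_mem_sum_rep.2 ⟨hr, hy⟩, hxd, hud,
        Or.inr ⟨y, hyx, rfl⟩⟩

theorem realizerVersion_of_baire (v : Baire → Set Baire) :
    realizerVersion ⟨RepSpace.baire, RepSpace.baire, v⟩ = v := by
  funext p
  ext r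
  constructor
  · rintro ⟨x, hx, y, hy, h⟩
    rwa [Part.mem_some_iff.1 hx, Part.mem_some_iff.1 hy] at h
  · exact fun h => ⟨p, Part.mem_some p, r, Part.mem_some r, h⟩

theorem dom_parallelization_completion_nonempty (f : Problem) :
    f.completion.parallelization.dom.Nonempty := by
  have h := totalPower_nonempty f.realizerVersion id
  rw [← realizerVersion_parallelization_completion] at h
  obtain ⟨x, -, hx⟩ := realizerVersion_nonempty.1 h
  exact ⟨x, hx⟩

end Problem

/-! ### Lattice laws and deduction for problems including `∞` -/

namespace ExtProblem

open Baire

theorem of_lePtW_of {f g : Problem} :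
    (of f).LePtW (of g) ↔ Reduces f.realizerVersion (totalPower g.realizerVersion) := by
  rw [← Problem.realizerVersion_parallelization_completion]
  exact Problem.leW_iff

theorem lePtW_infty (f : ExtProblem) : f.LePtW infty := by cases f <;> exact trivial

theorem not_infty_lePtW_of (f : Problem) : ¬ infty.LePtW (of f) := fun h => h

theorem lePtW_refl (f : ExtProblem) : f.LePtW f := by
  cases f with
  | of f => exact of_lePtW_of.2 (Reduces.totalPower_self _)
  | infty => exact lePtW_infty _

theorem lePtW_trans {f g h : ExtProblem} (h₁ : f.LePtW g) (h₂ : g.LePtW h) : f.LePtW h := by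
  cases h with
  | infty => exact lePtW_infty _
  | of h =>
    cases g with
    | infty => exact (not_infty_lePtW_of _ h₂).elim
    | of g =>
      cases f with
      | infty => exact (not_infty_lePtW_of _ h₁).elim
      | of f =>
        exact of_lePtW_of.2 ((of_lePtW_of.1 h₁).trans (of_lePtW_of.1 h₂).totalPower_of)

theorem of_lePtW_of_of_reduces {f g : Problem}
    (h : Reduces f.realizerVersion g.realizerVersion) : (of f).LePtW (of g) :=
  of_lePtW_of.2 (h.trans (Reduces.totalPower_self _))

theorem parCompl_lePtW (f : ExtProblem) : f.parCompl.LePtW f := by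
  cases f with
  | infty => exact lePtW_infty _
  | of f =>
    refine of_lePtW_of.2 ?_
    rw [Problem.realizerVersion_parallelization_completion]
    exact (Reduces.totalPower_self _).totalPower_of

theorem lePtW_parCompl (f : ExtProblem) : f.LePtW f.parCompl := by
  cases f with
  | infty => exact lePtW_infty _
  | of f =>
    refine of_lePtW_of_of_reduces ?_
    rw [Problem.realizerVersion_parallelization_completion]
    exact Reduces.totalPower_self _

theorem parComplMeet_lePtW_left (f g : ExtProblem) : (f.parComplMeet g).LePtW f := by
  cases f with
  | infty => exact lePtW_infty _
  | of f =>
    cases g with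
    | infty => exact parCompl_lePtW (of f)
    | of g =>
      refine lePtW_trans (of_lePtW_of_of_reduces ?_) (parCompl_lePtW (of f))
      rw [Problem.realizerVersion_meet]
      exact Reduces.meetMap_left

theorem parComplMeet_lePtW_right (f g : ExtProblem) : (f.parComplMeet g).LePtW g := by
  cases g with
  | infty => exact lePtW_infty _
  | of g =>
    cases f with
    | infty => exact parCompl_lePtW (of g)
    | of f =>
      refine lePtW_trans (of_lePtW_of_of_reduces ?_) (parCompl_lePtW (of g))
      rw [Problem.realizerVersion_meet]
      exact Reduces.meetMap_right

/-- The hypotheses are Weihrauch reductions to the parallelized completions; forming the meet from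
these makes `Reduces.meetMap_of` apply directly. -/
theorem lePtW_parComplMeet {f g h : ExtProblem} (h₁ : h.LePtW f) (h₂ : h.LePtW g) :
    h.LePtW (f.parComplMeet g) := by
  cases f with
  | infty =>
    cases g with
    | infty => exact lePtW_infty _
    | of g => exact lePtW_trans h₂ (lePtW_parCompl (of g))
  | of f =>
    cases g with
    | infty => exact lePtW_trans h₁ (lePtW_parCompl (of f))
    | of g =>
      cases h with
      | infty => exact (not_infty_lePtW_of _ h₁).elim
      | of h =>
        refine of_lePtW_of_of_reduces ?_
        rw [Problem.realizerVersion_meet, Problem.realizerVersion_parallelization_completion,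
          Problem.realizerVersion_parallelization_completion]
        exact Reduces.meetMap_of (of_lePtW_of.1 h₁) (of_lePtW_of.1 h₂)

theorem lePtW_coprod_left (f g : ExtProblem) : f.LePtW (f.coprod g) := by
  cases f with
  | infty => exact lePtW_infty _
  | of f =>
    cases g with
    | infty => exact lePtW_infty _
    | of g =>
      refine of_lePtW_of_of_reduces ?_
      rw [Problem.realizerVersion_coprod]
      exact Reduces.left_sumMap

theorem lePtW_coprod_right (f g : ExtProblem) : g.LePtW (f.coprod g) := by
  cases f with
  | infty => exact lePtW_infty _
  | of f =>
    cases g with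
    | infty => exact lePtW_infty _
    | of g =>
      refine of_lePtW_of_of_reduces ?_
      rw [Problem.realizerVersion_coprod]
      exact Reduces.right_sumMap

theorem coprod_lePtW {f g h : ExtProblem} (h₁ : f.LePtW h) (h₂ : g.LePtW h) :
    (f.coprod g).LePtW h := by
  cases h with
  | infty => exact lePtW_infty _
  | of h =>
    cases f with
    | infty => exact (not_infty_lePtW_of _ h₁).elim
    | of f =>
      cases g with
      | infty => exact (not_infty_lePtW_of _ h₂).elim
      | of g =>
        refine of_lePtW_of.2 ?_
        rw [Problem.realizerVersion_coprod]
        exact Reduces.sumMap_of (of_lePtW_of.1 h₁) (of_lePtW_of.1 h₂)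

theorem one_lePtW (f : ExtProblem) : (of Problem.one).LePtW f := by
  cases f with
  | infty => exact lePtW_infty _
  | of f =>
    refine of_lePtW_of.2 ?_
    have hone : Problem.one.realizerVersion = fun p => {p} := Problem.realizerVersion_of_baire _
    rw [hone]
    exact Reduces.identity_totalPower

theorem zero_lePtW (f : ExtProblem) : (of Problem.zero).LePtW f := by
  cases f with
  | infty => exact lePtW_infty _
  | of f =>
    refine of_lePtW_of.2 ?_
    have hzero : Problem.zero.realizerVersion = fun _ => ∅ := Problem.realizerVersion_of_baire _
    rw [hzero]
    exact Reduces.of_total FunComputable.id FunComputable.id fun p ⟨_, h⟩ => h.elim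

/-- A parallelized completion has nonempty domain, so the exceptional value `∞` of `↠` does not
occur. -/
theorem parComplMulImp_of (g f : Problem) : (of g).parComplMulImp (of f) =
    of (g.completion.parallelization.mulImpCore f.completion.parallelization) :=
  if_pos (Or.inl g.dom_parallelization_completion_nonempty)

theorem parComplMulImp_lePtW_iff (f g h : ExtProblem) :
    (g.parComplMulImp f).LePtW h ↔ f.LePtW (g.coprod h) := by
  cases g with
  | infty => exact iff_of_true (zero_lePtW h) (lePtW_infty f)
  | of g =>
    cases h with
    | infty => exact iff_of_true (lePtW_infty _) (lePtW_infty f)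
    | of h =>
      cases f with
      | infty => exact iff_of_false (not_infty_lePtW_of _) (not_infty_lePtW_of _)
      | of f =>
        rw [parComplMulImp_of]
        change _ ↔ (of f).LePtW (of (g.coprod h))
        rw [of_lePtW_of, of_lePtW_of, Problem.realizerVersion_coprod]
        have himp : (g.completion.parallelization.mulImpCore
            f.completion.parallelization).realizerVersion =
            impMap (totalPower g.realizerVersion) (totalPower f.realizerVersion) := by
          rw [← Problem.realizerVersion_parallelization_completion,
            ← Problem.realizerVersion_parallelization_completion]
          exact Problem.realizerVersion_of_baire _
        rw [himp]
        -- The implication involves the closure of `f`, which is total as `sumMap_of_impMap`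
        -- requires and lies below exactly the same parallelized completions as `f`.
        exact ⟨fun hle => (Reduces.totalPower_self _).trans
          (Reduces.sumMap_of_impMap (totalPower_nonempty _) hle),
          fun hle => Reduces.impMap_of_sumMap hle.totalPower_of⟩

theorem EquivPtW.of_monotone₂ {op : ExtProblem → ExtProblem → ExtProblem}
    (hop : ∀ {f f' g g'}, EquivPtW f f' → EquivPtW g g' → (op f g).LePtW (op f' g'))
    {f f' g g' : ExtProblem} (h₁ : f.EquivPtW f') (h₂ : g.EquivPtW g') :
    (op f g).EquivPtW (op f' g') :=
  ⟨hop h₁ h₂, hop h₁.symm h₂.symm⟩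

theorem EquivPtW.parComplMeet {f f' g g' : ExtProblem} (h₁ : f.EquivPtW f') (h₂ : g.EquivPtW g') :
    (f.parComplMeet g).EquivPtW (f'.parComplMeet g') :=
  of_monotone₂ (fun h₁ h₂ => lePtW_parComplMeet (lePtW_trans (parComplMeet_lePtW_left _ _) h₁.1)
    (lePtW_trans (parComplMeet_lePtW_right _ _) h₂.1)) h₁ h₂

theorem EquivPtW.coprod {f f' g g' : ExtProblem} (h₁ : f.EquivPtW f') (h₂ : g.EquivPtW g') :
    (f.coprod g).EquivPtW (f'.coprod g') :=
  of_monotone₂ (fun h₁ h₂ => coprod_lePtW (lePtW_trans h₁.1 (lePtW_coprod_left _ _))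
    (lePtW_trans h₂.1 (lePtW_coprod_right _ _))) h₁ h₂

/-- Formal from deduction: `f ≤ f' ≤ g' ⊔ (g' ⇛ f') ≤ g ⊔ (g' ⇛ f')`. -/
theorem parComplMulImp_mono {f f' g g' : ExtProblem} (h₁ : g'.LePtW g) (h₂ : f.LePtW f') :
    (g.parComplMulImp f).LePtW (g'.parComplMulImp f') :=
  (parComplMulImp_lePtW_iff _ _ _).2 (lePtW_trans h₂ (lePtW_trans
    ((parComplMulImp_lePtW_iff _ _ _).1 (lePtW_refl _))
    (coprod_lePtW (lePtW_trans h₁ (lePtW_coprod_left _ _)) (lePtW_coprod_right _ _))))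

theorem EquivPtW.parComplMulImp {f f' g g' : ExtProblem} (h₁ : g.EquivPtW g')
    (h₂ : f.EquivPtW f') : (g.parComplMulImp f).EquivPtW (g'.parComplMulImp f') :=
  of_monotone₂ (fun h₁ h₂ => parComplMulImp_mono h₁.2 h₂.1) h₁ h₂

end ExtProblem

/-! ### Passage to degrees -/

namespace PtWDegree

open ExtProblem

theorem le_deg_iff {f g : ExtProblem} : (deg f).Le (deg g) ↔ f.LePtW g := by
  constructor
  · rintro ⟨f', hf, g', hg, h⟩
    exact lePtW_trans hf.2 (lePtW_trans h hg.1)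
  · exact fun h => ⟨f, ⟨lePtW_refl f, lePtW_refl f⟩, g, ⟨lePtW_refl g, lePtW_refl g⟩, h⟩

theorem deg_eq_deg {f g : ExtProblem} (h : f.EquivPtW g) : deg f = deg g :=
  Subtype.ext (Set.ext fun _ => ⟨fun hk => ⟨lePtW_trans hk.1 h.1, lePtW_trans h.2 hk.2⟩,
    fun hk => ⟨lePtW_trans hk.1 h.2, lePtW_trans h.1 hk.2⟩⟩)

theorem exists_deg_eq (D : PtWDegree) : ∃ f, D = deg f :=
  D.2.imp fun _ h => Subtype.ext h

theorem exists_lift₂ {op : ExtProblem → ExtProblem → ExtProblem}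
    (hop : ∀ {f f' g g'}, EquivPtW f f' → EquivPtW g g' → (op f g).EquivPtW (op f' g')) :
    ∃ lift : PtWDegree → PtWDegree → PtWDegree, ∀ f g, lift (deg f) (deg g) = deg (op f g) := by
  choose s hs using exists_deg_eq
  have key : ∀ f, (s (deg f)).EquivPtW f := fun f =>
    ⟨le_deg_iff.1 (by rw [← hs]; exact le_deg_iff.2 (lePtW_refl f)),
      le_deg_iff.1 (by rw [← hs]; exact le_deg_iff.2 (lePtW_refl f))⟩
  exact ⟨fun D E => deg (op (s D) (s E)), fun f g => deg_eq_deg (hop (key f) (key g))⟩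

end PtWDegree

/-- A bounded lattice with an operation that satisfies the deduction property is a Brouwer
algebra. -/
theorem isBrouwerAlgebra_of_lattice {X : Type*} {le : X → X → Prop} {inf sup imp : X → X → X}
    {bot top : X} (le_refl : ∀ x, le x x) (le_trans : ∀ x y z, le x y → le y z → le x z)
    (le_antisymm : ∀ x y, le x y → le y x → x = y)
    (inf_le_left : ∀ x y, le (inf x y) x) (inf_le_right : ∀ x y, le (inf x y) y)
    (le_inf : ∀ x y z, le z x → le z y → le z (inf x y))
    (le_sup_left : ∀ x y, le x (sup x y)) (le_sup_right : ∀ x y, le y (sup x y))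
    (sup_le : ∀ x y z, le x z → le y z → le (sup x y) z)
    (bot_le : ∀ x, le bot x) (le_top : ∀ x, le x top)
    (deductive : ∀ x y z, le x (sup y z) ↔ le (imp y x) z) :
    IsBrouwerAlgebra le inf sup imp bot top := by
  have sup_mono : ∀ x x' y y', le x x' → le y y' → le (sup x y) (sup x' y') :=
    fun x x' y y' hx hy => sup_le _ _ _ (le_trans _ _ _ hx (le_sup_left _ _))
      (le_trans _ _ _ hy (le_sup_right _ _))
  have sup_comm_le : ∀ x y, le (sup x y) (sup y x) := fun x y =>
    sup_le _ _ _ (le_sup_right _ _) (le_sup_left _ _)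
  exact
    { le_refl, le_trans, le_antisymm, inf_le_left, inf_le_right, le_inf, le_sup_left, le_sup_right
      sup_le, bot_le, le_top, deductive
      mul_assoc := fun x y z => le_antisymm _ _
        (sup_le _ _ _ (sup_mono _ _ _ _ (le_refl x) (le_sup_left y z))
          (le_trans _ _ _ (le_sup_right y z) (le_sup_right _ _)))
        (sup_le _ _ _ (le_trans _ _ _ (le_sup_left x y) (le_sup_left _ _))
          (sup_mono _ _ _ _ (le_sup_right x y) (le_refl z)))
      one_mul := fun x => le_antisymm _ _ (sup_le _ _ _ (bot_le x) (le_refl x)) (le_sup_right _ _)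
      mul_one := fun x => le_antisymm _ _ (sup_le _ _ _ (le_refl x) (bot_le x)) (le_sup_left _ _)
      mul_mono := sup_mono
      mul_comm := fun x y => le_antisymm _ _ (sup_comm_le x y) (sup_comm_le y x)
      imp_mono := fun x x' y y' hx hy => (deductive _ _ _).1 (le_trans _ _ _ hy (le_trans _ _ _
        ((deductive _ _ _).2 (le_refl _)) (sup_mono _ _ _ _ hx (le_refl _))))
      imp_le := fun x y z => (deductive x y z).1 }

/-- Parallelized total Weihrauch reducibility is a preorder, the order and the operations are
well-defined on degrees, and the degrees form a Brouwer algebra with them. -/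
theorem mainTheorem1 :
    (∀ f : ExtProblem, f.LePtW f) ∧
    (∀ f g h : ExtProblem, f.LePtW g → g.LePtW h → f.LePtW h) ∧
    (∀ f g : ExtProblem, (PtWDegree.deg f).Le (PtWDegree.deg g) ↔ f.LePtW g) ∧
    ∃ meet join imp : PtWDegree → PtWDegree → PtWDegree,
      (∀ f g : ExtProblem,
        meet (PtWDegree.deg f) (PtWDegree.deg g) = PtWDegree.deg (f.parComplMeet g)) ∧
      (∀ f g : ExtProblem,
        join (PtWDegree.deg f) (PtWDegree.deg g) = PtWDegree.deg (f.coprod g)) ∧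
      (∀ g f : ExtProblem,
        imp (PtWDegree.deg g) (PtWDegree.deg f) = PtWDegree.deg (g.parComplMulImp f)) ∧
      IsBrouwerAlgebra PtWDegree.Le meet join imp
        (PtWDegree.deg (ExtProblem.of Problem.one)) (PtWDegree.deg ExtProblem.infty) := by
  obtain ⟨meet, hmeet⟩ := PtWDegree.exists_lift₂ ExtProblem.EquivPtW.parComplMeet
  obtain ⟨join, hjoin⟩ := PtWDegree.exists_lift₂ ExtProblem.EquivPtW.coprod
  obtain ⟨imp, himp⟩ := PtWDegree.exists_lift₂ ExtProblem.EquivPtW.parComplMulImp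
  refine ⟨ExtProblem.lePtW_refl, fun _ _ _ => ExtProblem.lePtW_trans,
    fun _ _ => PtWDegree.le_deg_iff, meet, join, imp, hmeet, hjoin, himp, ?_⟩
  -- Surjectivity of `deg` reduces every law to representatives.
  have hsurj : Function.Surjective PtWDegree.deg := fun D => (PtWDegree.exists_deg_eq D).imp
    fun _ => Eq.symm
  refine isBrouwerAlgebra_of_lattice ?_ ?_ ?_ ?_ ?_ ?_ ?_ ?_ ?_ ?_ ?_ ?_ <;>
    simp only [hsurj.forall, hmeet, hjoin, himp, PtWDegree.le_deg_iff]
  · exact ExtProblem.lePtW_refl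
  · exact fun _ _ _ => ExtProblem.lePtW_trans
  · exact fun _ _ h₁ h₂ => PtWDegree.deg_eq_deg ⟨h₁, h₂⟩
  · exact ExtProblem.parComplMeet_lePtW_left
  · exact ExtProblem.parComplMeet_lePtW_right
  · exact fun _ _ _ => ExtProblem.lePtW_parComplMeet
  · exact ExtProblem.lePtW_coprod_left
  · exact ExtProblem.lePtW_coprod_right
  · exact fun _ _ _ => ExtProblem.coprod_lePtW
  · exact ExtProblem.one_lePtW
  · exact ExtProblem.lePtW_infty
  · exact fun f g h => (ExtProblem.parComplMulImp_lePtW_iff f g h).symm
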